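/- Let $\mathcal F$ be a signature in which every function symbol has a fixed finite arity, let $\mathcal F_{AC}\subseteq\mathcal F$ be a set of binary symbols, and let $\mathcal V$ be a set of variables. Let $=_{AC}$ be the congruence on terms induced by the equations $f(x,y)\approx f(y,x)$ and $f(f(x,y),z)\approx f(x,f(y,z))$ for all $f\in\mathcal F_{AC}$. *Precedence and weights.* Let $>$ be a precedence, i.e. an irreflexive and transitive relation on $\mathcal F$. Let $(w,w_0)$ be a weight function: $w\colon\mathcal F\to\mathbb N$ and $w_0\in\mathbb N$ with $w_0>0$ and $w(c)\ge w_0$ for every constant $c$. The weight of a term is $w(x)=w_0$ for $x\in\mathcal V$ and $w(f(t_1,\dots,t_n))=w(f)+\sum_i w(t_i)$. Assume that $(w,w_0)$ is admissible for $>$: every unary $f$ with $w(f)=0$ satisfies $f>g$ for all function symbols $g\ne f$. Write $|t|_x$ for the number of occurrences of the variable $x$ in $t$. *Extensions of relations.* For a pair $(\succsim,\succ)$ of relations on a set: - $(x_1,\dots,x_n)\succ^{lex}(y_1,\dots,y_n)$ iff for some $0\le k<n$ we have $x_i\succsim y_i$ for all $i\le k$ and $x_{k+1}\succ y_{k+1}$.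 - For finite multisets $M$, $N$ of cardinalities $m$, $n$, write $M\sqsupset_k N$ if their elements can be enumerated as $x_1,\dots,x_m$ and $y_1,\dots,y_n$ such that $x_j\succsim y_j$ for all $j\le k$, and for every $k<j\le n$ there is $k<i\le m$ with $x_i\succ y_j$. Then $M\succsim^{mul}N$ iff $M\sqsupset_k N$ for some $0\le k\le\min(m,n)$, and $M\succ^{mul}N$ iff $M\sqsupset_k N$ for some $0\le k\le\min(m-1,n)$. *Top-flattening.* For $f\in\mathcal F_{AC}$ the multiset $\mathrm{tf}_f(t)$ is $\{t\}$ if the root of $t$ is not $f$, and $\mathrm{tf}_f(t_1)\uplus\mathrm{tf}_f(t_2)$ if $t=f(t_1,t_2)$. For a multiset $T$ of terms let $T{\restriction}_{\mathcal V}$ be the submultiset of variables in $T$, and let $T{\restriction}_f^{<}$ and $T{\restriction}_f^{\nless}$ be the submultisets of non-variable terms $t\in T$ with $\mathrm{root}(t)<f$ and with $\mathrm{root}(t)\nless f$, respectively. For a relation $R$ on terms with multiset extension $R^{mul}$, write $S\mathrel{R^f}T$ iff $$S{\restriction}_f^{\nless}\;R^{mul}\;T{\restriction}_f^{\nless}\uplus(T{\restriction}_{\mathcal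 V}-S{\restriction}_{\mathcal V}).$$ *The order.* Define $>_{ACKBO}$ inductively: $s>_{ACKBO}t$ iff $|s|_x\ge|t|_x$ for all $x\in\mathcal V$ and either $w(s)>w(t)$, or $w(s)=w(t)$ and one of the following holds: 0. $s=f^k(t)$ and $t\in\mathcal V$ for some unary $f$ and some $k>0$; 1. $s=f(s_1,\dots,s_n)$, $t=g(t_1,\dots,t_m)$ and $f>g$; 2. $s=f(s_1,\dots,s_n)$, $t=f(t_1,\dots,t_n)$, $f\notin\mathcal F_{AC}$ and $(s_1,\dots,s_n)>_{ACKBO}^{lex}(t_1,\dots,t_n)$; 3. $s=f(s_1,s_2)$, $t=f(t_1,t_2)$, $f\in\mathcal F_{AC}$, and for $S=\mathrm{tf}_f(s)$ and $T=\mathrm{tf}_f(t)$ one of (a) $S>_{ACKBO}^{f}T$; (b) $S=_{AC}^{f}T$ and $|S|>|T|$; (c) $S=_{AC}^{f}T$, $|S|=|T|$ and $S{\restriction}_f^{<}>_{ACKBO}^{mul}T{\restriction}_f^{<}$. Here all lexicographic and multiset extensions are those of the pair $(\succsim,\succ)=({=_{AC}},{>_{ACKBO}})$; in particular $=_{AC}^{mul}$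 is $\succsim^{mul}$ for this pair. **Theorem.** The relation $>_{ACKBO}$ is an AC-compatible simplification order. That is, it is irreflexive and transitive; it is closed under contexts ($s>_{ACKBO}t$ implies $C[s]>_{ACKBO}C[t]$ for every context $C$) and under substitutions ($s>_{ACKBO}t$ implies $s\sigma>_{ACKBO}t\sigma$ for every substitution $\sigma$); it has the subterm property $f(t_1,\dots,t_n)>_{ACKBO}t_i$ for all $f\in\mathcal F$ and $1\le i\le n$; and ${=_{AC}}\cdot{>_{ACKBO}}\cdot{=_{AC}}\subseteq{>_{ACKBO}}$. -/

import Mathlib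

namespace ACKBO

universe u v u'

/-- Function symbols (of all arities) of the signature `L`; a symbol carries its arity. -/
abbrev FSym (L : FirstOrder.Language.{u, v}) : Type u := Σ n, L.Functions n

section Extensions

variable {A : Type*}

/-- Strict lexicographic extension of the pair `(ge, gt)` to tuples of the same length. -/
def lexGt (ge gt : A → A → Prop) {n : ℕ} (x y : Fin n → A) : Prop :=
  ∃ i : Fin n, (∀ j < i, ge (x j) (y j)) ∧ gt (x i) (y i)

/-- Nonstrict multiset extension of the pair `(ge, gt)`: some `k` elements of `M` and `N` are
paired by `ge`, and every remaining element of `N` is below a remaining element of `M`. -/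
def mulGe (ge gt : A → A → Prop) (M N : Multiset A) : Prop :=
  ∃ M₁ M₂ N₁ N₂ : Multiset A, M = M₁ + M₂ ∧ N = N₁ + N₂ ∧ Multiset.Rel ge M₁ N₁ ∧
    ∀ y ∈ N₂, ∃ x ∈ M₂, gt x y

/-- Strict multiset extension of the pair `(ge, gt)`: as `mulGe`, but at least one element of `M`
is not paired by `ge`. -/
def mulGt (ge gt : A → A → Prop) (M N : Multiset A) : Prop :=
  ∃ M₁ M₂ N₁ N₂ : Multiset A, M = M₁ + M₂ ∧ N = N₁ + N₂ ∧ Multiset.Rel ge M₁ N₁ ∧ M₂ ≠ 0 ∧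
    ∀ y ∈ N₂, ∃ x ∈ M₂, gt x y

theorem lexGt_mono {ge gt gt' : A → A → Prop} (h : ∀ a b, gt a b → gt' a b) {n : ℕ}
    {x y : Fin n → A} : lexGt ge gt x y → lexGt ge gt' x y := by
  rintro ⟨i, h₁, h₂⟩
  exact ⟨i, h₁, h _ _ h₂⟩

theorem mulGe_mono {ge gt gt' : A → A → Prop} (h : ∀ a b, gt a b → gt' a b)
    {M N : Multiset A} : mulGe ge gt M N → mulGe ge gt' M N := by
  rintro ⟨M₁, M₂, N₁, N₂, h₁, h₂, h₃, h₄⟩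
  refine ⟨M₁, M₂, N₁, N₂, h₁, h₂, h₃, fun y hy => ?_⟩
  obtain ⟨x, hx, hxy⟩ := h₄ y hy
  exact ⟨x, hx, h _ _ hxy⟩

theorem mulGt_mono {ge gt gt' : A → A → Prop} (h : ∀ a b, gt a b → gt' a b)
    {M N : Multiset A} : mulGt ge gt M N → mulGt ge gt' M N := by
  rintro ⟨M₁, M₂, N₁, N₂, h₁, h₂, h₃, h₄, h₅⟩
  refine ⟨M₁, M₂, N₁, N₂, h₁, h₂, h₃, h₄, fun y hy => ?_⟩
  obtain ⟨x, hx, hxy⟩ := h₅ y hy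
  exact ⟨x, hx, h _ _ hxy⟩

end Extensions

section Terms

variable {L : FirstOrder.Language.{u, v}} {V : Type u'}

/-- The congruence `=_AC` induced by commutativity and associativity of the binary symbols
in `ac`. -/
inductive ACEq (ac : Set (L.Functions 2)) : L.Term V → L.Term V → Prop
  | comm (f : L.Functions 2) (hf : f ∈ ac) (s t : L.Term V) :
      ACEq ac (f.apply₂ s t) (f.apply₂ t s)
  | assoc (f : L.Functions 2) (hf : f ∈ ac) (s t r : L.Term V) :
      ACEq ac (f.apply₂ (f.apply₂ s t) r) (f.apply₂ s (f.apply₂ t r))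
  | refl (s : L.Term V) : ACEq ac s s
  | symm {s t : L.Term V} : ACEq ac s t → ACEq ac t s
  | trans {s t r : L.Term V} : ACEq ac s t → ACEq ac t r → ACEq ac s r
  | congr {n : ℕ} (f : L.Functions n) {ss ts : Fin n → L.Term V} :
      (∀ i, ACEq ac (ss i) (ts i)) → ACEq ac (.func f ss) (.func f ts)

/-- One-hole contexts. In `app f i ts C` the `i`-th argument of `f` is the context `C`, the other
arguments are given by `ts` (the entry `ts i` is ignored). -/
inductive Ctx (L : FirstOrder.Language.{u, v}) (V : Type u') : Type (max u u')
  | hole : Ctx L V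
  | app {n : ℕ} (f : L.Functions n) (i : Fin n) (ts : Fin n → L.Term V) (C : Ctx L V) : Ctx L V

/-- The term `C[s]`. -/
def Ctx.fill : Ctx L V → L.Term V → L.Term V
  | .hole, s => s
  | .app f i ts C, s => .func f (Function.update ts i (C.fill s))

/-- AC-compatible simplification orders. -/
structure IsACSimplificationOrder (ac : Set (L.Functions 2))
    (gt : L.Term V → L.Term V → Prop) : Prop where
  irrefl : ∀ s, ¬ gt s s
  trans : ∀ s t r, gt s t → gt t r → gt s r
  closed_ctx : ∀ (C : Ctx L V) (s t), gt s t → gt (C.fill s) (C.fill t)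
  closed_subst : ∀ (σ : V → L.Term V) (s t), gt s t → gt (s.subst σ) (t.subst σ)
  subterm : ∀ {n : ℕ} (f : L.Functions n) (ts : Fin n → L.Term V) (i : Fin n),
    gt (.func f ts) (ts i)
  ac_compat : ∀ s s' t' t, ACEq ac s s' → gt s' t' → ACEq ac t' t → gt s t

/-- Precedences are proper orders on the function symbols; `prec f g` is read `f > g`. -/
structure IsPrecedence (prec : FSym L → FSym L → Prop) : Prop where
  irrefl : ∀ f, ¬ prec f f
  trans : ∀ f g h, prec f g → prec g h → prec f h

/-- Weight functions `(w, w₀)`. -/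
structure WeightFunction (L : FirstOrder.Language.{u, v}) where
  w : FSym L → ℕ
  w₀ : ℕ
  w₀_pos : 0 < w₀
  const_ge : ∀ c : L.Functions 0, w₀ ≤ w ⟨0, c⟩

/-- The weight of a term. -/
def WeightFunction.weight (W : WeightFunction L) : L.Term V → ℕ
  | .var _ => W.w₀
  | .func (l := n) f ts => W.w ⟨n, f⟩ + ∑ i, W.weight (ts i)

/-- `W` is admissible for `prec` if every unary symbol of weight zero is greater than all other
function symbols. -/
def WeightFunction.Admissible (W : WeightFunction L) (prec : FSym L → FSym L → Prop) : Prop :=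
  ∀ f : L.Functions 1, W.w ⟨1, f⟩ = 0 → ∀ g : FSym L, g ≠ ⟨1, f⟩ → prec ⟨1, f⟩ g

open Classical in
/-- `|t|_x`, the number of occurrences of the variable `x` in `t`. -/
noncomputable def varCount (x : V) : L.Term V → ℕ
  | .var y => if y = x then 1 else 0
  | .func _ ts => ∑ i, varCount x (ts i)

/-- The root symbol of a term; variables have none. -/
def root : L.Term V → Option (FSym L)
  | .var _ => none
  | .func (l := n) f _ => some ⟨n, f⟩

open Classical in
/-- The top-flattening of a term with respect to `f`. -/
noncomputable def topFlat (f : L.Functions 2) : L.Term V → Multiset (L.Term V)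
  | .var x => {.var x}
  | .func (l := n) g ts =>
      if (⟨n, g⟩ : FSym L) = ⟨2, f⟩ then ∑ i, topFlat f (ts i) else {.func g ts}

open Classical in
/-- The submultiset of variables in `T`. -/
noncomputable def varPart (T : Multiset (L.Term V)) : Multiset (L.Term V) :=
  T.filter fun t => ∃ x, t = .var x

open Classical in
/-- The submultiset of those non-variable terms in `T` whose root is smaller than `f`. -/
noncomputable def lessPart (prec : FSym L → FSym L → Prop) (f : FSym L)
    (T : Multiset (L.Term V)) : Multiset (L.Term V) :=
  T.filter fun t => ∃ g, root t = some g ∧ prec f g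

open Classical in
/-- The submultiset of those non-variable terms in `T` whose root is not smaller than `f`. -/
noncomputable def notLessPart (prec : FSym L → FSym L → Prop) (f : FSym L)
    (T : Multiset (L.Term V)) : Multiset (L.Term V) :=
  T.filter fun t => ∃ g, root t = some g ∧ ¬ prec f g

open Classical in
/-- The relation on multisets of terms obtained from a relation `Rmul` on multisets of terms by
comparing the non-variable terms of `S` whose root is not smaller than `f` with those of `T`
together with the variables of `T` that are not cancelled by variables of `S`. -/
def restrictedExt (prec : FSym L → FSym L → Prop) (f : FSym L)
    (Rmul : Multiset (L.Term V) → Multiset (L.Term V) → Prop)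
    (S T : Multiset (L.Term V)) : Prop :=
  Rmul (notLessPart prec f S) (notLessPart prec f T + (varPart T - varPart S))

/-- Case 3: comparison of the top-flattenings `S` and `T` of two terms with AC root `f`. -/
def FlatStep (ac : Set (L.Functions 2)) (prec : FSym L → FSym L → Prop)
    (gt : L.Term V → L.Term V → Prop) (f : FSym L) (S T : Multiset (L.Term V)) : Prop :=
  restrictedExt prec f (mulGt (ACEq ac) gt) S T ∨
  (restrictedExt prec f (mulGe (ACEq ac) gt) S T ∧ S.card > T.card) ∨
  (restrictedExt prec f (mulGe (ACEq ac) gt) S T ∧ S.card = T.card ∧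
    mulGt (ACEq ac) gt (lessPart prec f S) (lessPart prec f T))

/-- The clauses of the inductive definition of the order, with `gt` in place of the recursive
occurrences of the order. -/
def Step (ac : Set (L.Functions 2)) (prec : FSym L → FSym L → Prop) (W : WeightFunction L)
    (gt : L.Term V → L.Term V → Prop) (s t : L.Term V) : Prop :=
  (∀ x, varCount x s ≥ varCount x t) ∧
  (W.weight s > W.weight t ∨
    W.weight s = W.weight t ∧
      ((∃ (f : L.Functions 1) (k : ℕ) (x : V), 0 < k ∧ t = .var x ∧ s = f.apply₁^[k] t) ∨
       (∃ (n m : ℕ) (f : L.Functions n) (g : L.Functions m)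
          (ss : Fin n → L.Term V) (ts : Fin m → L.Term V),
          s = .func f ss ∧ t = .func g ts ∧ prec ⟨n, f⟩ ⟨m, g⟩) ∨
       (∃ (n : ℕ) (f : L.Functions n) (ss ts : Fin n → L.Term V),
          s = .func f ss ∧ t = .func f ts ∧ (∀ g ∈ ac, (⟨n, f⟩ : FSym L) ≠ ⟨2, g⟩) ∧
          lexGt (ACEq ac) gt ss ts) ∨
       (∃ f ∈ ac, ∃ s₁ s₂ t₁ t₂ : L.Term V,
          s = f.apply₂ s₁ s₂ ∧ t = f.apply₂ t₁ t₂ ∧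
          FlatStep ac prec gt ⟨2, f⟩ (topFlat f s) (topFlat f t))))

theorem Step_mono (ac : Set (L.Functions 2)) (prec : FSym L → FSym L → Prop)
    (W : WeightFunction L) :
    Monotone (Step (V := V) ac prec W) := by
  intro R R' h s t
  have h' : ∀ a b, R a b → R' a b := h
  rintro ⟨hv, hw⟩
  refine ⟨hv, hw.imp id (And.imp id (Or.imp id (Or.imp id (Or.imp ?_ ?_))))⟩
  · rintro ⟨n, f, ss, ts, h₁, h₂, h₃, h₄⟩
    exact ⟨n, f, ss, ts, h₁, h₂, h₃, lexGt_mono h' h₄⟩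
  · rintro ⟨f, hf, s₁, s₂, t₁, t₂, h₁, h₂, h₃⟩
    refine ⟨f, hf, s₁, s₂, t₁, t₂, h₁, h₂, ?_⟩
    rcases h₃ with h₃ | ⟨h₃, h₄⟩ | ⟨h₃, h₄, h₅⟩
    · exact Or.inl (mulGt_mono h' h₃)
    · exact Or.inr (Or.inl ⟨mulGe_mono h' h₃, h₄⟩)
    · exact Or.inr (Or.inr ⟨mulGe_mono h' h₃, h₄, mulGt_mono h' h₅⟩)

/-- The order `>_ACKBO`: the least relation closed under the clauses of `Step`. -/
def acKBO (ac : Set (L.Functions 2)) (prec : FSym L → FSym L → Prop) (W : WeightFunction L) :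
    L.Term V → L.Term V → Prop :=
  OrderHom.lfp ⟨Step ac prec W, Step_mono ac prec W⟩

theorem acKBO_iff (ac : Set (L.Functions 2)) (prec : FSym L → FSym L → Prop)
    (W : WeightFunction L) (s t : L.Term V) :
    acKBO ac prec W s t ↔ Step ac prec W (acKBO ac prec W) s t :=
  (iff_of_eq (congrFun (congrFun (OrderHom.map_lfp
    (⟨Step ac prec W, Step_mono ac prec W⟩ :
      (L.Term V → L.Term V → Prop) →o (L.Term V → L.Term V → Prop))) s) t)).symm

end Terms

end ACKBO

/-!
The main properties are proved by induction on the size of the larger term. What makes this work for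
the AC symbols is that the multiset extensions can be used inside such inductions: `mulExt.of_rel`
and `mulExt.trans` use compatibility and transitivity of the base order only for elements of the
larger multiset, and the elements of the top-flattening of a term are smaller than the term. So
AC-compatibility (`acKBO_compat`) comes first: AC-equivalent terms agree in weight, variables and
root, and their top-flattenings agree up to AC equivalence of the elements (`ACEq.topFlat_rel`).
Transitivity (`acKBO_trans`) uses it, together with the inequality `U - S ≤ (U - T) + (T - S)` for
the uncancelled variables (`flatExt.trans`). Irreflexivity (`acKBO_irrefl`) follows, since after
cancellation of AC-equivalent elements a multiset above itself would be finite, nonempty and without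
maximal elements.

Admissibility enters through `acKBO_var_iff`, by which a variable is below exactly those terms that
properly contain it, and through the subterm property: an argument can have the weight of the whole
term only below a unary symbol of weight zero, which is the greatest symbol.

For contexts with root `f` in `ac`, `flatStep_of_acKBO` shows that `s > t` with equal weights
decreases the top-flattening with respect to `f`, whatever the roots of `s` and `t` are, and adding
the same multiset on both sides preserves this. For substitutions, only the variables in a
top-flattening can flatten further (`parts_flatSubst`). The variables that occur on both sides
contribute the same multiset; an uncancelled variable on the right was strictly below some element
on the left, hence the elements of its flattened instance are so too, by the subterm property;
uncancelled variables on the left only help. When there is an uncancelled variable on the right, the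
comparison is already strict (`flatExt.strict_of_varPart_not_le`), so the cardinalities, which a
substitution could change in the wrong direction, are not needed.
-/

namespace ACKBO

universe u v u'

open FirstOrder.Language

/-! ### Multiset extensions -/

section Multisets

variable {A B : Type*} {ge gt : A → A → Prop} {p q : Prop}

/-- The common form of the two multiset extensions: the proposition `p` says whether the extension
has to be strict, so that `mulGe` is the case `p = False` and `mulGt` the case `p = True`. -/
def mulExt (p : Prop) (ge gt : A → A → Prop) (M N : Multiset A) : Prop :=
  ∃ M₁ M₂ N₁ N₂ : Multiset A, M = M₁ + M₂ ∧ N = N₁ + N₂ ∧ Multiset.Rel ge M₁ N₁ ∧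
    (p → M₂ ≠ 0) ∧ ∀ y ∈ N₂, ∃ x ∈ M₂, gt x y

theorem mulGe_iff_mulExt {M N : Multiset A} : mulGe ge gt M N ↔ mulExt False ge gt M N := by
  simp [mulGe, mulExt]

theorem mulGt_iff_mulExt {M N : Multiset A} : mulGt ge gt M N ↔ mulExt True ge gt M N := by
  simp [mulGt, mulExt]

theorem mulExt.imp {M N : Multiset A} (h : mulExt p ge gt M N) (hqp : q → p) :
    mulExt q ge gt M N := by
  obtain ⟨M₁, M₂, N₁, N₂, h₁, h₂, h₃, h₄, h₅⟩ := h
  exact ⟨M₁, M₂, N₁, N₂, h₁, h₂, h₃, fun hq => h₄ (hqp hq), h₅⟩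

theorem mulExt_of_le (hrefl : ∀ x, ge x x) {M N : Multiset A} (h : N ≤ M) :
    mulExt False ge gt M N := by
  obtain ⟨K, rfl⟩ := Multiset.le_iff_exists_add.1 h
  exact ⟨N, K, N, 0, rfl, by simp, Multiset.rel_refl_of_refl_on fun x _ => hrefl x, by simp,
    by simp⟩

theorem mulExt_singleton_left {x : A} {N : Multiset A} (h : ∀ y ∈ N, gt x y) :
    mulExt True ge gt {x} N :=
  ⟨0, {x}, 0, N, by simp, by simp, Multiset.Rel.zero, by simp, fun y hy => ⟨x, by simp, h y hy⟩⟩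

theorem mulExt.add {M N M' N' : Multiset A} (h : mulExt p ge gt M N)
    (h' : mulExt q ge gt M' N') : mulExt (p ∨ q) ge gt (M + M') (N + N') := by
  obtain ⟨M₁, M₂, N₁, N₂, rfl, rfl, h₃, h₄, h₅⟩ := h
  obtain ⟨M₁', M₂', N₁', N₂', rfl, rfl, h₃', h₄', h₅'⟩ := h'
  refine ⟨M₁ + M₁', M₂ + M₂', N₁ + N₁', N₂ + N₂', by abel, by abel, h₃.add h₃', ?_, ?_⟩
  · rintro (hp | hq) h
    · exact h₄ hp (add_eq_zero.1 h).1
    · exact h₄' hq (add_eq_zero.1 h).2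
  · intro y hy
    rcases Multiset.mem_add.1 hy with hy | hy
    · obtain ⟨x, hx, hxy⟩ := h₅ y hy
      exact ⟨x, Multiset.mem_add.2 (Or.inl hx), hxy⟩
    · obtain ⟨x, hx, hxy⟩ := h₅' y hy
      exact ⟨x, Multiset.mem_add.2 (Or.inr hx), hxy⟩

theorem mulExt_bind {M : Multiset B} {F G : B → Multiset A}
    (h : ∀ b ∈ M, mulExt False ge gt (F b) (G b)) :
    mulExt False ge gt (M.bind F) (M.bind G) := by
  induction M using Multiset.induction with
  | empty => exact ⟨0, 0, 0, 0, by simp, by simp, Multiset.Rel.zero, by simp, by simp⟩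
  | cons b M ih =>
    rw [Multiset.cons_bind, Multiset.cons_bind]
    refine ((h b (Multiset.mem_cons_self b M)).add
      (ih fun c hc => h c (Multiset.mem_cons_of_mem hc))).imp (by simp)

theorem mulExt.map {M N : Multiset A} (h : mulExt p ge gt M N) (f : A → A)
    (hge : ∀ x y, ge x y → ge (f x) (f y)) (hgt : ∀ x ∈ M, ∀ y, gt x y → gt (f x) (f y)) :
    mulExt p ge gt (M.map f) (N.map f) := by
  obtain ⟨M₁, M₂, N₁, N₂, rfl, rfl, h₃, h₄, h₅⟩ := h
  refine ⟨M₁.map f, M₂.map f, N₁.map f, N₂.map f, by simp, by simp, ?_, by simpa using h₄, ?_⟩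
  · exact Multiset.rel_map.2 (h₃.mono fun x _ y _ hxy => hge x y hxy)
  · intro z hz
    obtain ⟨y, hy, rfl⟩ := Multiset.mem_map.1 hz
    obtain ⟨x, hx, hxy⟩ := h₅ y hy
    exact ⟨f x, Multiset.mem_map_of_mem f hx, hgt x (by simp [hx]) y hxy⟩

theorem exists_mem_right_of_rel {r : A → A → Prop} {M N : Multiset A} (h : Multiset.Rel r M N)
    {x : A} (hx : x ∈ M) : ∃ y ∈ N, r x y :=
  Multiset.exists_mem_of_rel_of_mem h hx

theorem exists_mem_left_of_rel {r : A → A → Prop} {M N : Multiset A} (h : Multiset.Rel r M N)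
    {y : A} (hy : y ∈ N) : ∃ x ∈ M, r x y :=
  Multiset.exists_mem_of_rel_of_mem (Multiset.rel_flip.2 h) hy

/-- The compatibility of `ge` with `gt` is only needed for elements of the larger multiset: this
makes the lemma usable inside an induction on terms. -/
theorem mulExt.of_rel (htrans : ∀ x y z, ge x y → ge y z → ge x z) {M M' N' N : Multiset A}
    (hM : Multiset.Rel ge M M') (h : mulExt p ge gt M' N') (hN : Multiset.Rel ge N' N)
    (hcompat : ∀ x ∈ M, ∀ x' y' y, ge x x' → gt x' y' → ge y' y → gt x y) :
    mulExt p ge gt M N := by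
  have : IsTrans A ge := ⟨htrans⟩
  obtain ⟨M₁', M₂', N₁', N₂', rfl, rfl, h₃, h₄, h₅⟩ := h
  obtain ⟨M₁, M₂, hM₁, hM₂, rfl⟩ := Multiset.rel_add_right.1 hM
  obtain ⟨N₁, N₂, hN₁, hN₂, rfl⟩ := Multiset.rel_add_left.1 hN
  refine ⟨M₁, M₂, N₁, N₂, rfl, rfl, (hM₁.trans ge h₃).trans ge hN₁, ?_, ?_⟩
  · rintro hp rfl
    exact h₄ hp (Multiset.rel_zero_left.1 hM₂)
  · intro y hy
    obtain ⟨y', hy', hyy⟩ := exists_mem_left_of_rel hN₂ hy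
    obtain ⟨x', hx', hxy⟩ := h₅ y' hy'
    obtain ⟨x, hx, hxx⟩ := exists_mem_left_of_rel hM₂ hx'
    exact ⟨x, hx, hcompat x (by simp [hx]) x' y' y hxx hxy hyy⟩

theorem exists_refinement_of_add_eq_add {M N P Q : Multiset A} (h : M + N = P + Q) :
    ∃ a b c d : Multiset A, M = a + b ∧ N = c + d ∧ P = a + c ∧ Q = b + d := by
  classical
  refine ⟨M ∩ P, M - P, P - M, N - (P - M), ?_, ?_, ?_, ?_⟩ <;> ext x <;>
    have hx := congrArg (Multiset.count x) h <;>
    simp only [Multiset.count_add, Multiset.count_inter, Multiset.count_sub] at hx ⊢ <;> omega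

/-- Composition of multiset extensions, strict as soon as one of the two factors is. Transitivity of
`gt` is only needed below elements of the largest multiset. -/
theorem mulExt.trans (htrans : ∀ x y z, ge x y → ge y z → ge x z)
    (hl : ∀ x y z, ge x y → gt y z → gt x z) (hr : ∀ x y z, gt x y → ge y z → gt x z)
    {M N K : Multiset A} (hgt : ∀ x ∈ M, ∀ y z, gt x y → gt y z → gt x z)
    (h : mulExt p ge gt M N) (h' : mulExt q ge gt N K) : mulExt (p ∨ q) ge gt M K := by
  have : IsTrans A ge := ⟨htrans⟩
  obtain ⟨M₁, M₂, N₁, N₂, rfl, rfl, h₃, h₄, h₅⟩ := h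
  obtain ⟨P₁, P₂, K₁, K₂, hP, rfl, h₃', h₄', h₅'⟩ := h'
  obtain ⟨a, b, c, d, rfl, rfl, rfl, rfl⟩ := exists_refinement_of_add_eq_add hP
  obtain ⟨Ma, Mb, ha, hb, rfl⟩ := Multiset.rel_add_right.1 h₃
  obtain ⟨Ka, Kc, ha', hc', rfl⟩ := Multiset.rel_add_left.1 h₃'
  refine ⟨Ma, Mb + M₂, Ka, Kc + K₂, by abel, by abel, ha.trans ge ha', ?_, ?_⟩
  · intro hpq h0
    obtain ⟨rfl, rfl⟩ := add_eq_zero.1 h0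
    obtain rfl := Multiset.rel_zero_left.1 hb
    rcases hpq with hp | hq
    · exact h₄ hp rfl
    · refine h₄' hq ?_
      rw [zero_add]
      refine Multiset.eq_zero_of_forall_notMem fun y hy => ?_
      obtain ⟨x, hx, -⟩ := h₅ y (by simp [hy])
      simp at hx
  · intro z hz
    rcases Multiset.mem_add.1 hz with hz | hz
    · obtain ⟨y, hy, hyz⟩ := exists_mem_left_of_rel hc' hz
      obtain ⟨x, hx, hxy⟩ := h₅ y (by simp [hy])
      exact ⟨x, by simp [hx], hr _ _ _ hxy hyz⟩
    · obtain ⟨y, hy, hyz⟩ := h₅' z hz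
      rcases Multiset.mem_add.1 hy with hy | hy
      · obtain ⟨x, hx, hxy⟩ := exists_mem_left_of_rel hb hy
        exact ⟨x, by simp [hx], hl _ _ _ hxy hyz⟩
      · obtain ⟨x, hx, hxy⟩ := h₅ y (by simp [hy])
        exact ⟨x, by simp [hx], hgt x (by simp [hx]) _ _ hxy hyz⟩

theorem rel_of_add_eq_add {r : A → A → Prop} (hr : Equivalence r) {M₁ M₂ N₁ N₂ : Multiset A}
    (h : M₁ + M₂ = N₁ + N₂) (h₁ : Multiset.Rel r M₁ N₁) : Multiset.Rel r M₂ N₂ := by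
  let S : Setoid A := ⟨r, hr⟩
  have key : ∀ M N : Multiset A,
      Multiset.Rel r M N ↔ M.map (Quotient.mk S) = N.map (Quotient.mk S) := by
    intro M N
    rw [← Multiset.rel_eq, Multiset.rel_map]
    have : (fun a b => Quotient.mk S a = Quotient.mk S b) = r := by
      funext a b
      exact propext Quotient.eq
    rw [this]
  rw [key] at h₁ ⊢
  have h₂ := congrArg (Multiset.map (Quotient.mk S)) h
  rw [Multiset.map_add, Multiset.map_add, h₁] at h₂
  exact add_left_cancel h₂

theorem exists_maximal_of_ne_zero {M : Multiset A}
    (hgt : ∀ x y z, gt x y → gt y z → gt x z) (hirr : ∀ x ∈ M, ¬ gt x x) (hM : M ≠ 0) :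
    ∃ y ∈ M, ∀ x ∈ M, ¬ gt x y := by
  induction M using Multiset.induction with
  | empty => exact absurd rfl hM
  | cons a M ih =>
    by_cases h0 : M = 0
    · subst h0
      exact ⟨a, by simp, fun x hx => by
        obtain rfl : x = a := by simpa using hx
        exact hirr x (by simp)⟩
    obtain ⟨y, hy, hmax⟩ := ih (fun x hx => hirr x (Multiset.mem_cons_of_mem hx)) h0
    by_cases hay : gt a y
    · refine ⟨a, by simp, fun x hx hxa => ?_⟩
      rcases Multiset.mem_cons.1 hx with rfl | hx
      · exact hirr x (by simp) hxa
      · exact hmax x hx (hgt _ _ _ hxa hay)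
    · refine ⟨y, by simp [hy], fun x hx hxy => ?_⟩
      rcases Multiset.mem_cons.1 hx with rfl | hx
      · exact hay hxy
      · exact hmax x hx hxy

/-- If `M` were above itself, cancelling the paired elements would leave a nonempty finite multiset
without maximal elements. -/
theorem mulExt_irrefl (hge : Equivalence ge)
    (hr : ∀ x y z, gt x y → ge y z → gt x z)
    (hgt : ∀ x y z, gt x y → gt y z → gt x z) {M : Multiset A} (hirr : ∀ x ∈ M, ¬ gt x x) :
    ¬ mulExt True ge gt M M := by
  rintro ⟨M₁, M₂, N₁, N₂, rfl, h₂, h₃, h₄, h₅⟩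
  have hrel := rel_of_add_eq_add hge h₂ h₃
  obtain ⟨y, hy, hmax⟩ := exists_maximal_of_ne_zero hgt
    (fun x hx => hirr x (Multiset.mem_add.2 (Or.inr hx))) (h₄ trivial)
  obtain ⟨z, hz, hyz⟩ := exists_mem_right_of_rel hrel hy
  obtain ⟨x, hx, hxz⟩ := h₅ z hz
  exact hmax x hx (hr _ _ _ hxz (hge.symm hyz))

end Multisets

section Terms

variable {L : FirstOrder.Language.{u, v}} {V : Type u'}

/-! ### Terms, top-flattenings and AC equivalence -/

/-- The number of function symbols in a term. -/
def size : L.Term V → ℕ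
  | .var _ => 0
  | .func _ ts => 1 + ∑ i, size (ts i)

theorem size_arg_lt {n : ℕ} (f : L.Functions n) (ts : Fin n → L.Term V) (i : Fin n) :
    size (ts i) < size (Term.func f ts) := by
  have := Finset.single_le_sum (f := fun i => size (ts i)) (fun _ _ => Nat.zero_le _)
    (Finset.mem_univ i)
  simp only [size] at this ⊢
  omega

theorem root_eq_none {t : L.Term V} : root t = none ↔ ∃ x, t = .var x := by
  cases t <;> simp [root]

theorem root_eq_some {t : L.Term V} {n : ℕ} {f : L.Functions n} :
    root t = some ⟨n, f⟩ ↔ ∃ ts, t = .func f ts := by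
  constructor
  · intro h
    cases t with
    | var x => simp [root] at h
    | func g ts =>
      simp only [root, Option.some.injEq] at h
      cases h
      exact ⟨ts, rfl⟩
  · rintro ⟨ts, rfl⟩
    rfl

theorem func_eq_apply₂ (f : L.Functions 2) (ts : Fin 2 → L.Term V) :
    Term.func f ts = f.apply₂ (ts 0) (ts 1) := by
  simp only [Functions.apply₂]
  congr 1
  ext i
  fin_cases i <;> rfl

theorem func_eq_apply₁ (f : L.Functions 1) (ts : Fin 1 → L.Term V) :
    Term.func f ts = f.apply₁ (ts 0) := by
  simp only [Functions.apply₁]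
  congr 1
  ext i
  fin_cases i
  rfl

theorem topFlat_func (f : L.Functions 2) (ts : Fin 2 → L.Term V) :
    topFlat f (Term.func f ts) = topFlat f (ts 0) + topFlat f (ts 1) := by
  simp [topFlat]

theorem topFlat_of_root_ne {f : L.Functions 2} {t : L.Term V} (h : root t ≠ some ⟨2, f⟩) :
    topFlat f t = {t} := by
  cases t with
  | var x => rfl
  | func g ts =>
    rw [topFlat, if_neg]
    rintro heq
    exact h (congrArg some heq)

/-- Induction along the top-flattening with respect to `f`. -/
theorem topFlat_induction (f : L.Functions 2) {P : L.Term V → Prop}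
    (base : ∀ t, root t ≠ some ⟨2, f⟩ → P t)
    (step : ∀ ts : Fin 2 → L.Term V, P (ts 0) → P (ts 1) → P (.func f ts)) (t : L.Term V) :
    P t := by
  induction t with
  | var x => exact base _ (by simp [root])
  | func g ts ih =>
    by_cases h : root (Term.func g ts) = some ⟨2, f⟩
    · simp only [root, Option.some.injEq] at h
      cases h
      exact step ts (ih 0) (ih 1)
    · exact base _ h

theorem root_ne_of_mem_topFlat {f : L.Functions 2} {t u : L.Term V} (h : u ∈ topFlat f t) :
    root u ≠ some ⟨2, f⟩ := by
  induction t using topFlat_induction f with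
  | base t ht =>
    rw [topFlat_of_root_ne ht, Multiset.mem_singleton] at h
    rwa [h]
  | step ts h₀ h₁ =>
    rw [topFlat_func, Multiset.mem_add] at h
    exact h.elim h₀ h₁

theorem size_le_of_mem_topFlat {f : L.Functions 2} {t u : L.Term V} (h : u ∈ topFlat f t) :
    size u ≤ size t := by
  induction t using topFlat_induction f with
  | base t ht =>
    rw [topFlat_of_root_ne ht, Multiset.mem_singleton] at h
    rw [h]
  | step ts h₀ h₁ =>
    rw [topFlat_func, Multiset.mem_add] at h
    rcases h with h | h
    · exact (h₀ h).trans (size_arg_lt f ts 0).le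
    · exact (h₁ h).trans (size_arg_lt f ts 1).le

theorem size_lt_of_mem_topFlat {f : L.Functions 2} {ts : Fin 2 → L.Term V} {u : L.Term V}
    (h : u ∈ topFlat f (Term.func f ts)) : size u < size (Term.func f ts) := by
  rw [topFlat_func, Multiset.mem_add] at h
  rcases h with h | h
  · exact (size_le_of_mem_topFlat h).trans_lt (size_arg_lt f ts 0)
  · exact (size_le_of_mem_topFlat h).trans_lt (size_arg_lt f ts 1)

theorem one_le_card_topFlat (f : L.Functions 2) (t : L.Term V) : 1 ≤ (topFlat f t).card := by
  induction t using topFlat_induction f with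
  | base t ht => simp [topFlat_of_root_ne ht]
  | step ts h₀ h₁ =>
    rw [topFlat_func, Multiset.card_add]
    omega

theorem topFlat_subst (f : L.Functions 2) (σ : V → L.Term V) (t : L.Term V) :
    topFlat f (t.subst σ) = (topFlat f t).bind fun u => topFlat f (u.subst σ) := by
  induction t using topFlat_induction f with
  | base t ht => simp [topFlat_of_root_ne ht]
  | step ts h₀ h₁ =>
    rw [topFlat_func, Multiset.add_bind, ← h₀, ← h₁]
    exact topFlat_func f fun i => (ts i).subst σ

theorem root_subst {t : L.Term V} (σ : V → L.Term V) (h : ¬ ∃ x, t = .var x) :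
    root (t.subst σ) = root t := by
  cases t with
  | var x => exact absurd ⟨x, rfl⟩ h
  | func f ts => rfl

variable {ac : Set (L.Functions 2)}

theorem ACEq.equivalence : Equivalence (ACEq (V := V) ac) :=
  ⟨ACEq.refl, ACEq.symm, ACEq.trans⟩

theorem ACEq.root_eq {s t : L.Term V} (h : ACEq ac s t) : root s = root t := by
  induction h with
  | comm => rfl
  | assoc => rfl
  | refl => rfl
  | symm _ ih => exact ih.symm
  | trans _ _ ih ih' => exact ih.trans ih'
  | congr => rfl

theorem ACEq.varCount_eq {s t : L.Term V} (h : ACEq ac s t) (x : V) :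
    varCount x s = varCount x t := by
  induction h with
  | comm => simp [Functions.apply₂, varCount, add_comm]
  | assoc => simp [Functions.apply₂, varCount, add_assoc]
  | refl => rfl
  | symm _ ih => exact ih.symm
  | trans _ _ ih ih' => exact ih.trans ih'
  | congr f _ ih => simp [varCount, ih]

theorem ACEq.weight_eq (W : WeightFunction L) {s t : L.Term V} (h : ACEq ac s t) :
    W.weight s = W.weight t := by
  induction h with
  | comm => simp [Functions.apply₂, WeightFunction.weight, add_comm]
  | assoc => simp [Functions.apply₂, WeightFunction.weight]; ring
  | refl => rfl
  | symm _ ih => exact ih.symm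
  | trans _ _ ih ih' => exact ih.trans ih'
  | congr f _ ih => simp [WeightFunction.weight, ih]

theorem ACEq.eq_var {s : L.Term V} {x : V} (h : ACEq ac s (.var x)) : s = .var x := by
  obtain ⟨y, rfl⟩ := root_eq_none.1 h.root_eq
  have := h.varCount_eq x
  by_contra hne
  rw [varCount, varCount, if_pos rfl, if_neg] at this
  · exact zero_ne_one this
  · rintro rfl
    exact hne rfl

theorem ACEq.args {s t : L.Term V} (h : ACEq ac s t) {n : ℕ} {f : L.Functions n}
    (hf : ∀ g ∈ ac, (⟨n, f⟩ : FSym L) ≠ ⟨2, g⟩) :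
    (∀ ss, s = .func f ss → ∃ ts, t = .func f ts ∧ ∀ i, ACEq ac (ss i) (ts i)) ∧
    (∀ ts, t = .func f ts → ∃ ss, s = .func f ss ∧ ∀ i, ACEq ac (ts i) (ss i)) := by
  induction h with
  | comm g hg =>
    constructor <;> intro ss h <;> cases h <;> exact absurd rfl (hf g hg)
  | assoc g hg =>
    constructor <;> intro ss h <;> cases h <;> exact absurd rfl (hf g hg)
  | refl => exact ⟨fun ss h => ⟨ss, h, fun i => .refl _⟩, fun ss h => ⟨ss, h, fun i => .refl _⟩⟩
  | symm _ ih => exact ⟨ih.2, ih.1⟩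
  | trans _ _ ih ih' =>
    constructor
    · intro ss h
      obtain ⟨ts, h, hts⟩ := ih.1 ss h
      obtain ⟨us, h, hus⟩ := ih'.1 ts h
      exact ⟨us, h, fun i => (hts i).trans (hus i)⟩
    · intro us h
      obtain ⟨ts, h, hts⟩ := ih'.2 us h
      obtain ⟨ss, h, hss⟩ := ih.2 ts h
      exact ⟨ss, h, fun i => (hts i).trans (hss i)⟩
  | congr g hst =>
    constructor <;> intro ss h <;> cases h
    · exact ⟨_, rfl, hst⟩
    · exact ⟨_, rfl, fun i => (hst i).symm⟩

theorem rel_ACEq_refl (S : Multiset (L.Term V)) : Multiset.Rel (ACEq ac) S S :=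
  Multiset.rel_refl_of_refl_on fun x _ => .refl x

/-- AC-equivalent terms have top-flattenings that agree up to AC equivalence of their elements. -/
theorem ACEq.topFlat_rel (f : L.Functions 2) {s t : L.Term V} (h : ACEq ac s t) :
    Multiset.Rel (ACEq ac) (topFlat f s) (topFlat f t) := by
  have htr : IsTrans (L.Term V) (ACEq ac) := ⟨fun _ _ _ => ACEq.trans⟩
  have single : ∀ {s t : L.Term V}, ACEq ac s t → root s ≠ some ⟨2, f⟩ →
      Multiset.Rel (ACEq ac) (topFlat f s) (topFlat f t) := by
    intro s t h hs
    rw [topFlat_of_root_ne hs, topFlat_of_root_ne (h.root_eq ▸ hs)]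
    exact Multiset.Rel.cons h Multiset.Rel.zero
  induction h with
  | comm g hg s t =>
    by_cases hgf : g = f
    · subst hgf
      rw [Functions.apply₂, Functions.apply₂, topFlat_func, topFlat_func, add_comm]
      exact rel_ACEq_refl _
    · exact single (.comm g hg s t) (by simpa [Functions.apply₂, root] using hgf)
  | assoc g hg s t r =>
    by_cases hgf : g = f
    · subst hgf
      simp only [Functions.apply₂, topFlat_func, Matrix.cons_val_zero, Matrix.cons_val_one,
        add_assoc]
      exact rel_ACEq_refl _
    · exact single (.assoc g hg s t r) (by simpa [Functions.apply₂, root] using hgf)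
  | refl s => exact rel_ACEq_refl _
  | symm _ ih => exact Multiset.rel_flip.1 (ih.mono fun _ _ _ _ h => h.symm)
  | trans _ _ ih ih' => exact ih.trans _ ih'
  | congr g h ih =>
    rename_i n ss ts
    by_cases hgf : root (Term.func g ss) = some ⟨2, f⟩
    · simp only [root, Option.some.injEq] at hgf
      cases hgf
      rw [topFlat_func, topFlat_func]
      exact (ih 0).add (ih 1)
    · exact single (.congr g h) hgf

theorem apply₂_subst (f : L.Functions 2) (s t : L.Term V) (σ : V → L.Term V) :
    (f.apply₂ s t).subst σ = f.apply₂ (s.subst σ) (t.subst σ) :=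
  func_eq_apply₂ f fun i => (![s, t] i).subst σ

theorem ACEq.subst (σ : V → L.Term V) {s t : L.Term V} (h : ACEq ac s t) :
    ACEq ac (s.subst σ) (t.subst σ) := by
  induction h with
  | comm f hf s t =>
    rw [apply₂_subst, apply₂_subst]
    exact .comm f hf _ _
  | assoc f hf s t r =>
    simp only [apply₂_subst]
    exact .assoc f hf _ _ _
  | refl => exact .refl _
  | symm _ ih => exact ih.symm
  | trans _ _ ih ih' => exact ih.trans ih'
  | congr f _ ih => exact .congr f ih

/-! ### Parts of a multiset of terms -/

variable {prec : FSym L → FSym L → Prop}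

theorem rel_filter {A : Type*} {r : A → A → Prop} (P : A → Prop) [DecidablePred P]
    (hP : ∀ a b, r a b → (P a ↔ P b)) {S T : Multiset A} (h : Multiset.Rel r S T) :
    Multiset.Rel r (S.filter P) (T.filter P) := by
  induction h with
  | zero => exact Multiset.Rel.zero
  | @cons a b S T hab _ ih =>
    by_cases ha : P a
    · rw [Multiset.filter_cons_of_pos _ ha, Multiset.filter_cons_of_pos _ ((hP _ _ hab).1 ha)]
      exact Multiset.Rel.cons hab ih
    · rw [Multiset.filter_cons_of_neg _ ha,
        Multiset.filter_cons_of_neg _ (fun hb => ha ((hP _ _ hab).2 hb))]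
      exact ih

theorem notLessPart_rel (f : FSym L) {S T : Multiset (L.Term V)}
    (h : Multiset.Rel (ACEq ac) S T) :
    Multiset.Rel (ACEq ac) (notLessPart prec f S) (notLessPart prec f T) := by
  classical
  exact rel_filter _ (fun a b hab => by rw [hab.root_eq]) h

theorem lessPart_rel (f : FSym L) {S T : Multiset (L.Term V)}
    (h : Multiset.Rel (ACEq ac) S T) :
    Multiset.Rel (ACEq ac) (lessPart prec f S) (lessPart prec f T) := by
  classical
  exact rel_filter _ (fun a b hab => by rw [hab.root_eq]) h

theorem varPart_eq_of_rel {S T : Multiset (L.Term V)} (h : Multiset.Rel (ACEq ac) S T) :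
    varPart S = varPart T := by
  classical
  have hrel : Multiset.Rel (ACEq ac) (varPart S) (varPart T) :=
    rel_filter _ (fun a b hab => by rw [← root_eq_none, ← root_eq_none, hab.root_eq]) h
  rw [← Multiset.rel_eq]
  refine hrel.mono fun a _ b hb hab => ?_
  obtain ⟨x, rfl⟩ := (Multiset.mem_filter.1 hb).2
  exact hab.eq_var

theorem notLessPart_add (f : FSym L) (S T : Multiset (L.Term V)) :
    notLessPart prec f (S + T) = notLessPart prec f S + notLessPart prec f T := by
  classical
  exact Multiset.filter_add _ _ _

theorem lessPart_add (f : FSym L) (S T : Multiset (L.Term V)) :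
    lessPart prec f (S + T) = lessPart prec f S + lessPart prec f T := by
  classical
  exact Multiset.filter_add _ _ _

theorem varPart_add (S T : Multiset (L.Term V)) : varPart (S + T) = varPart S + varPart T := by
  classical
  exact Multiset.filter_add _ _ _

theorem parts_singleton_of_less {f : FSym L} {t : L.Term V} {g : FSym L} (ht : root t = some g)
    (hg : prec f g) :
    notLessPart prec f {t} = 0 ∧ lessPart prec f {t} = {t} ∧ varPart {t} = 0 := by
  have hv : ¬ ∃ x, t = .var x := by
    rw [← root_eq_none, ht]
    simp
  simp [notLessPart, lessPart, varPart, Multiset.filter_singleton, ht, hg, hv]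

theorem parts_singleton_of_not_less {f : FSym L} {t : L.Term V} {g : FSym L}
    (ht : root t = some g) (hg : ¬ prec f g) :
    notLessPart prec f {t} = {t} ∧ lessPart prec f {t} = 0 ∧ varPart {t} = 0 := by
  have hv : ¬ ∃ x, t = .var x := by
    rw [← root_eq_none, ht]
    simp
  simp [notLessPart, lessPart, varPart, Multiset.filter_singleton, ht, hg, hv]

theorem parts_singleton_var (f : FSym L) (x : V) :
    notLessPart prec f {(.var x : L.Term V)} = 0 ∧ lessPart prec f {(.var x : L.Term V)} = 0 ∧
      varPart {(.var x : L.Term V)} = {.var x} := by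
  have hr : root (.var x : L.Term V) = none := rfl
  simp [notLessPart, lessPart, varPart, Multiset.filter_singleton, hr]

theorem parts_add (f : FSym L) (S : Multiset (L.Term V)) :
    notLessPart prec f S + lessPart prec f S + varPart S = S := by
  induction S using Multiset.induction with
  | empty => simp [notLessPart, lessPart, varPart]
  | cons t S ih =>
    rw [← Multiset.singleton_add, notLessPart_add, lessPart_add, varPart_add]
    have : notLessPart prec f {t} + lessPart prec f {t} + varPart {t} = {t} := by
      cases hr : root t with
      | none =>
        obtain ⟨x, rfl⟩ := root_eq_none.1 hr
        obtain ⟨h₁, h₂, h₃⟩ := parts_singleton_var (prec := prec) f x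
        rw [h₁, h₂, h₃, zero_add, zero_add]
      | some g =>
        by_cases hg : prec f g
        · obtain ⟨h₁, h₂, h₃⟩ := parts_singleton_of_less hr hg
          rw [h₁, h₂, h₃, zero_add, add_zero]
        · obtain ⟨h₁, h₂, h₃⟩ := parts_singleton_of_not_less hr hg
          rw [h₁, h₂, h₃, add_zero, add_zero]
    conv_rhs => rw [← this, ← ih]
    abel

theorem parts_le (f : FSym L) (S : Multiset (L.Term V)) :
    notLessPart prec f S + varPart S ≤ S := by
  conv_rhs => rw [← parts_add (prec := prec) f S, add_right_comm]
  exact Multiset.le_add_right _ _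

/-! ### Weights and variables -/

/-- The multiset of variable occurrences of a term. -/
noncomputable def vars : L.Term V → Multiset V
  | .var x => {x}
  | .func _ ts => ∑ i, vars (ts i)

open Classical in
theorem varCount_eq_count (x : V) (t : L.Term V) : varCount x t = (vars t).count x := by
  induction t with
  | var y => simp [varCount, vars, Multiset.count_singleton, eq_comm]
  | func f ts ih => simp [varCount, vars, ih, Multiset.count_sum']

theorem vars_le {s t : L.Term V} (h : ∀ x, varCount x s ≥ varCount x t) : vars t ≤ vars s := by
  classical
  rw [Multiset.le_iff_count]
  intro x
  have := h x
  rw [varCount_eq_count, varCount_eq_count] at this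
  convert this

theorem sum_map_vars_func {n : ℕ} (f : L.Functions n) (ts : Fin n → L.Term V) (c : V → ℕ) :
    ((vars (Term.func f ts)).map c).sum = ∑ i, ((vars (ts i)).map c).sum := by
  rw [vars]
  exact map_sum ((Multiset.sumAddMonoidHom (M := ℕ)).comp (Multiset.mapAddMonoidHom c)) _ _

theorem varCount_subst (σ : V → L.Term V) (y : V) (t : L.Term V) :
    varCount y (t.subst σ) = ((vars t).map fun x => varCount y (σ x)).sum := by
  induction t with
  | var x => simp [vars]
  | func f ts ih =>
    rw [sum_map_vars_func, Term.subst, varCount]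
    simp [ih]

theorem varCount_subst_le (σ : V → L.Term V) {s t : L.Term V}
    (h : ∀ x, varCount x s ≥ varCount x t) (y : V) :
    varCount y (t.subst σ) ≤ varCount y (s.subst σ) := by
  rw [varCount_subst, varCount_subst]
  obtain ⟨K, hK⟩ := Multiset.le_iff_exists_add.1 (vars_le h)
  simp [hK]

theorem varCount_arg_le {n : ℕ} (f : L.Functions n) (ts : Fin n → L.Term V) (i : Fin n) (x : V) :
    varCount x (ts i) ≤ varCount x (Term.func f ts) :=
  Finset.single_le_sum (f := fun i => varCount x (ts i)) (fun _ _ => Nat.zero_le _)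
    (Finset.mem_univ i)

variable (W : WeightFunction L)

theorem WeightFunction.weight_arg_le {n : ℕ} (f : L.Functions n) (ts : Fin n → L.Term V)
    (i : Fin n) : W.weight (ts i) ≤ W.weight (Term.func f ts) :=
  (Finset.single_le_sum (f := fun i => W.weight (ts i)) (fun _ _ => Nat.zero_le _)
    (Finset.mem_univ i)).trans (Nat.le_add_left _ _)

theorem WeightFunction.w₀_le_weight (t : L.Term V) : W.w₀ ≤ W.weight t := by
  induction t with
  | var x => exact le_rfl
  | func f ts ih =>
    rename_i n
    cases n with
    | zero => exact (W.const_ge f).trans (Nat.le_add_right _ _)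
    | succ n => exact (ih 0).trans (W.weight_arg_le f ts 0)

/-- Only unary symbols of weight zero do not increase the weight. -/
theorem WeightFunction.unary_of_weight_le {n : ℕ} {f : L.Functions n} {ts : Fin n → L.Term V}
    {i : Fin n} (h : W.weight (Term.func f ts) ≤ W.weight (ts i)) :
    n = 1 ∧ W.w ⟨n, f⟩ = 0 := by
  have hsum := Finset.add_sum_erase Finset.univ (fun j => W.weight (ts j)) (Finset.mem_univ i)
  simp only [WeightFunction.weight] at h hsum
  have hw : W.w ⟨n, f⟩ = 0 := by omega
  refine ⟨?_, hw⟩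
  by_contra hn
  have : Nontrivial (Fin n) := Fin.nontrivial_iff_two_le.2 (by have := i.isLt; omega)
  obtain ⟨j, hj⟩ := exists_ne i
  have h₁ := Finset.single_le_sum (f := fun j => W.weight (ts j)) (fun _ _ => Nat.zero_le _)
    (Finset.mem_erase.2 ⟨hj, Finset.mem_univ j⟩)
  have h₂ := W.w₀_le_weight (ts j)
  have h₃ := W.w₀_pos
  omega

theorem WeightFunction.weight_subst (σ : V → L.Term V) (t : L.Term V) :
    W.weight (t.subst σ) =
      W.weight t + ((vars t).map fun x => W.weight (σ x) - W.w₀).sum := by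
  induction t with
  | var x =>
    have := W.w₀_le_weight (σ x)
    simp only [Term.subst, weight, vars, Multiset.map_singleton, Multiset.sum_singleton]
    omega
  | func f ts ih =>
    rw [sum_map_vars_func, Term.subst, weight, weight]
    simp only [ih, Finset.sum_add_distrib, add_assoc]

/-- A weight comparison is preserved by substitutions because the larger term contains at least as
many occurrences of every variable. -/
theorem WeightFunction.weight_subst_add_le (σ : V → L.Term V) {s t : L.Term V}
    (h : ∀ x, varCount x s ≥ varCount x t) :
    W.weight (t.subst σ) + W.weight s ≤ W.weight (s.subst σ) + W.weight t := by
  rw [W.weight_subst, W.weight_subst]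
  obtain ⟨K, hK⟩ := Multiset.le_iff_exists_add.1 (vars_le h)
  simp only [hK, Multiset.map_add, Multiset.sum_add]
  omega

theorem exists_varCount_pos {n : ℕ} {f : L.Functions n} {ts : Fin n → L.Term V} {x : V}
    (h : 0 < varCount x (Term.func f ts)) : ∃ i, 0 < varCount x (ts i) := by
  by_contra! hc
  rw [varCount, Finset.sum_eq_zero fun i _ => Nat.le_zero.1 (hc i)] at h
  exact lt_irrefl _ h

/-- A term of minimal weight that contains a variable `x` consists of `x` below a tower of unary
symbols of weight zero, which are all equal by admissibility. -/
theorem eq_iterate_of_weight_le (hprec : IsPrecedence prec) {W : WeightFunction L}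
    (hW : W.Admissible prec) {s : L.Term V} {x : V} (hx : 0 < varCount x s)
    (hs : W.weight s ≤ W.w₀) :
    s = .var x ∨ ∃ (f : L.Functions 1) (k : ℕ), 0 < k ∧ W.w ⟨1, f⟩ = 0 ∧
      s = f.apply₁^[k] (.var x) := by
  induction s with
  | var y =>
    left
    by_contra hne
    rw [varCount, if_neg] at hx
    · exact lt_irrefl _ hx
    · rintro rfl
      exact hne rfl
  | func f ts ih =>
    right
    obtain ⟨i, hi⟩ := exists_varCount_pos hx
    obtain ⟨rfl, hf⟩ := W.unary_of_weight_le (f := f) (ts := ts) (i := i)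
      (hs.trans (W.w₀_le_weight _))
    obtain rfl : i = 0 := Subsingleton.elim _ _
    rcases ih 0 hi ((W.weight_arg_le f ts 0).trans hs) with h | ⟨g, k, hk, hg, h⟩
    · exact ⟨f, 1, one_pos, hf, by rw [func_eq_apply₁, h]; rfl⟩
    · -- By admissibility, two distinct unary symbols of weight zero would be above each other.
      have hfg : f = g := by
        by_contra hne
        have h₁ := hW f hf ⟨1, g⟩ (by simpa using Ne.symm hne)
        have h₂ := hW g hg ⟨1, f⟩ (by simpa using hne)
        exact hprec.irrefl _ (hprec.trans _ _ _ h₁ h₂)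
      subst hfg
      exact ⟨f, k + 1, k.succ_pos, hf, by rw [func_eq_apply₁, h, Function.iterate_succ_apply']⟩

end Terms

section Order

variable {L : FirstOrder.Language.{u, v}} {V : Type u'} {ac : Set (L.Functions 2)}
  {prec : FSym L → FSym L → Prop} {W : WeightFunction L}

/-! ### Comparison of top-flattenings -/

open Classical in
/-- The relations `mulGe` (for `p = False`) and `mulGt` (for `p = True`) on multisets of terms,
restricted by a function symbol `f` as in `restrictedExt`. -/
def flatExt (p : Prop) (ac : Set (L.Functions 2)) (prec : FSym L → FSym L → Prop)
    (gt : L.Term V → L.Term V → Prop) (f : FSym L) (S T : Multiset (L.Term V)) : Prop :=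
  mulExt p (ACEq ac) gt (notLessPart prec f S) (notLessPart prec f T + (varPart T - varPart S))

theorem flatStep_iff {gt : L.Term V → L.Term V → Prop} {f : FSym L} {S T : Multiset (L.Term V)} :
    FlatStep ac prec gt f S T ↔
      flatExt True ac prec gt f S T ∨
      (flatExt False ac prec gt f S T ∧ S.card > T.card) ∨
      (flatExt False ac prec gt f S T ∧ S.card = T.card ∧
        mulExt True (ACEq ac) gt (lessPart prec f S) (lessPart prec f T)) := by
  simp only [FlatStep, restrictedExt, mulGe_iff_mulExt, mulGt_iff_mulExt]
  exact Iff.rfl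

variable {gt : L.Term V → L.Term V → Prop} {f : FSym L} {S S' T T' U : Multiset (L.Term V)}
  {p q : Prop}

theorem mem_of_mem_notLessPart {t : L.Term V} (h : t ∈ notLessPart prec f S) : t ∈ S := by
  classical
  exact (Multiset.mem_filter.1 h).1

theorem mem_of_mem_lessPart {t : L.Term V} (h : t ∈ lessPart prec f S) : t ∈ S := by
  classical
  exact (Multiset.mem_filter.1 h).1

theorem FlatStep.of_rel (hS : Multiset.Rel (ACEq ac) S S') (h : FlatStep ac prec gt f S' T')
    (hT : Multiset.Rel (ACEq ac) T' T)
    (hcompat : ∀ x ∈ S, ∀ x' y' y, ACEq ac x x' → gt x' y' → ACEq ac y' y → gt x y) :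
    FlatStep ac prec gt f S T := by
  have key : ∀ p, flatExt p ac prec gt f S' T' → flatExt p ac prec gt f S T := by
    intro p h
    rw [flatExt, ← varPart_eq_of_rel hS, varPart_eq_of_rel hT] at h
    exact h.of_rel (fun _ _ _ => ACEq.trans) (notLessPart_rel f hS)
      ((notLessPart_rel f hT).add (rel_ACEq_refl _))
      fun x hx => hcompat x (mem_of_mem_notLessPart hx)
  have hSc := Multiset.card_eq_card_of_rel hS
  have hTc := Multiset.card_eq_card_of_rel hT
  rw [flatStep_iff] at h ⊢
  rcases h with h | ⟨h, hc⟩ | ⟨h, hc, hless⟩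
  · exact Or.inl (key _ h)
  · exact Or.inr (Or.inl ⟨key _ h, by omega⟩)
  · exact Or.inr (Or.inr ⟨key _ h, by omega, hless.of_rel (fun _ _ _ => ACEq.trans)
      (lessPart_rel f hS) (lessPart_rel f hT) fun x hx => hcompat x (mem_of_mem_lessPart hx)⟩)

/-- Compatibility with AC equivalence, for an arbitrary relation on terms. -/
def ACCompat (ac : Set (L.Functions 2)) (gt : L.Term V → L.Term V → Prop) : Prop :=
  ∀ s s' t' t, ACEq ac s s' → gt s' t' → ACEq ac t' t → gt s t

theorem ACCompat.mulExt_trans (hc : ACCompat ac gt) {M N K : Multiset (L.Term V)}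
    (htrans : ∀ x ∈ M, ∀ y z, gt x y → gt y z → gt x z)
    (h : mulExt p (ACEq ac) gt M N) (h' : mulExt q (ACEq ac) gt N K) :
    mulExt (p ∨ q) (ACEq ac) gt M K :=
  mulExt.trans (fun _ _ _ => ACEq.trans) (fun x y z h₁ h₂ => hc x y z z h₁ h₂ (.refl z))
    (fun x y z h₁ h₂ => hc x x y z (.refl x) h₁ h₂) htrans h h'

theorem flatExt.trans (hc : ACCompat ac gt) (htrans : ∀ x ∈ S, ∀ y z, gt x y → gt y z → gt x z)
    (h : flatExt p ac prec gt f S T) (h' : flatExt q ac prec gt f T U) :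
    flatExt (p ∨ q) ac prec gt f S U := by
  classical
  have htr : ∀ x ∈ notLessPart prec f S, ∀ y z, gt x y → gt y z → gt x z :=
    fun x hx => htrans x (mem_of_mem_notLessPart hx)
  have h₁ := hc.mulExt_trans htr h
    (mulExt.add h' (mulExt_of_le (gt := gt) ACEq.refl (le_refl (varPart T - varPart S))))
  refine (hc.mulExt_trans htr h₁ (mulExt_of_le ACEq.refl ?_)).imp (q := p ∨ q) (by tauto)
  rw [add_assoc]
  exact add_le_add le_rfl tsub_le_tsub_add_tsub

theorem FlatStep.trans (hc : ACCompat ac gt)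
    (htrans : ∀ x ∈ S, ∀ y z, gt x y → gt y z → gt x z)
    (h : FlatStep ac prec gt f S T) (h' : FlatStep ac prec gt f T U) :
    FlatStep ac prec gt f S U := by
  have key : ∀ {p q r : Prop}, flatExt p ac prec gt f S T → flatExt q ac prec gt f T U →
      (r → p ∨ q) → flatExt r ac prec gt f S U := fun h h' hr => (h.trans hc htrans h').imp hr
  rw [flatStep_iff] at h h' ⊢
  rcases h with h | ⟨h, hcard⟩ | ⟨h, hcard, hless⟩ <;>
    rcases h' with h' | ⟨h', hcard'⟩ | ⟨h', hcard', hless'⟩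
  · exact Or.inl (key h h' (by simp))
  · exact Or.inl (key h h' (by simp))
  · exact Or.inl (key h h' (by simp))
  · exact Or.inl (key h h' (by simp))
  · exact Or.inr (Or.inl ⟨key h h' (by simp), by omega⟩)
  · exact Or.inr (Or.inl ⟨key h h' (by simp), by omega⟩)
  · exact Or.inl (key h h' (by simp))
  · exact Or.inr (Or.inl ⟨key h h' (by simp), by omega⟩)
  · exact Or.inr (Or.inr ⟨key h h' (by simp), by omega,
      (hc.mulExt_trans (fun x hx => htrans x (mem_of_mem_lessPart hx)) hless hless').imp
        (by simp)⟩)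

theorem FlatStep.irrefl (hc : ACCompat ac gt) (htrans : ∀ x y z, gt x y → gt y z → gt x z)
    (hirr : ∀ x ∈ S, ¬ gt x x) : ¬ FlatStep ac prec gt f S S := by
  classical
  have hr : ∀ x y z, gt x y → ACEq ac y z → gt x z := fun _ _ _ h₁ h₂ => hc _ _ _ _ (.refl _) h₁ h₂
  rw [flatStep_iff]
  rintro (h | ⟨-, h⟩ | ⟨-, -, h⟩)
  · rw [flatExt, tsub_self, add_zero] at h
    exact mulExt_irrefl ACEq.equivalence hr htrans
      (fun x hx => hirr x (mem_of_mem_notLessPart hx)) h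
  · exact lt_irrefl _ h
  · exact mulExt_irrefl ACEq.equivalence hr htrans
      (fun x hx => hirr x (mem_of_mem_lessPart hx)) h

theorem flatExt.add_right (U : Multiset (L.Term V)) (h : flatExt p ac prec gt f S T) :
    flatExt p ac prec gt f (S + U) (T + U) := by
  classical
  rw [flatExt, notLessPart_add, notLessPart_add, varPart_add, varPart_add,
    add_tsub_add_eq_tsub_right, add_right_comm]
  exact (mulExt.add h (mulExt_of_le ACEq.refl le_rfl)).imp (by simp)

theorem FlatStep.add_right (U : Multiset (L.Term V)) (h : FlatStep ac prec gt f S T) :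
    FlatStep ac prec gt f (S + U) (T + U) := by
  rw [flatStep_iff] at h ⊢
  rcases h with h | ⟨h, hcard⟩ | ⟨h, hcard, hless⟩
  · exact Or.inl (h.add_right U)
  · exact Or.inr (Or.inl ⟨h.add_right U, by simpa using hcard⟩)
  · refine Or.inr (Or.inr ⟨h.add_right U, by simpa using hcard, ?_⟩)
    rw [lessPart_add, lessPart_add]
    exact (hless.add (mulExt_of_le ACEq.refl le_rfl)).imp (by simp)

/-! ### Introduction and elimination rules -/

theorem acKBO.varCount_le {s t : L.Term V} (h : acKBO ac prec W s t) (x : V) :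
    varCount x t ≤ varCount x s :=
  ((acKBO_iff ac prec W s t).1 h).1 x

theorem acKBO.weight_le {s t : L.Term V} (h : acKBO ac prec W s t) :
    W.weight t ≤ W.weight s := by
  rcases ((acKBO_iff ac prec W s t).1 h).2 with hw | ⟨hw, -⟩ <;> omega

theorem acKBO_of_weight {s t : L.Term V} (hv : ∀ x, varCount x s ≥ varCount x t)
    (hw : W.weight s > W.weight t) : acKBO ac prec W s t :=
  (acKBO_iff ac prec W s t).2 ⟨hv, Or.inl hw⟩

theorem acKBO_of_prec {s t : L.Term V} (hv : ∀ x, varCount x s ≥ varCount x t)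
    (hw : W.weight s ≥ W.weight t) {g h : FSym L} (hs : root s = some g) (ht : root t = some h)
    (hgh : prec g h) : acKBO ac prec W s t := by
  obtain ⟨n, g⟩ := g
  obtain ⟨m, h⟩ := h
  obtain ⟨ss, rfl⟩ := root_eq_some.1 hs
  obtain ⟨ts, rfl⟩ := root_eq_some.1 ht
  exact (acKBO_iff ac prec W _ _).2
    ⟨hv, hw.lt_or_eq.imp id fun hw => ⟨hw.symm, Or.inr (Or.inl ⟨_, _, g, h, ss, ts, rfl, rfl, hgh⟩)⟩⟩

theorem acKBO_of_lex {n : ℕ} {f : L.Functions n} {ss ts : Fin n → L.Term V}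
    (hv : ∀ x, varCount x (Term.func f ss) ≥ varCount x (Term.func f ts))
    (hw : W.weight (Term.func f ss) ≥ W.weight (Term.func f ts))
    (hf : ∀ g ∈ ac, (⟨n, f⟩ : FSym L) ≠ ⟨2, g⟩)
    (h : lexGt (ACEq ac) (acKBO ac prec W) ss ts) :
    acKBO ac prec W (Term.func f ss) (Term.func f ts) :=
  (acKBO_iff ac prec W _ _).2
    ⟨hv, hw.lt_or_eq.imp id fun hw =>
      ⟨hw.symm, Or.inr (Or.inr (Or.inl ⟨n, f, ss, ts, rfl, rfl, hf, h⟩))⟩⟩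

theorem acKBO_of_flat {s t : L.Term V} {f : L.Functions 2} (hf : f ∈ ac)
    (hv : ∀ x, varCount x s ≥ varCount x t) (hw : W.weight s ≥ W.weight t)
    (hs : root s = some ⟨2, f⟩) (ht : root t = some ⟨2, f⟩)
    (h : FlatStep ac prec (acKBO ac prec W) ⟨2, f⟩ (topFlat f s) (topFlat f t)) :
    acKBO ac prec W s t := by
  obtain ⟨ss, rfl⟩ := root_eq_some.1 hs
  obtain ⟨ts, rfl⟩ := root_eq_some.1 ht
  exact (acKBO_iff ac prec W _ _).2
    ⟨hv, hw.lt_or_eq.imp id fun hw => ⟨hw.symm, Or.inr (Or.inr (Or.inr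
      ⟨f, hf, ss 0, ss 1, ts 0, ts 1, func_eq_apply₂ f ss, func_eq_apply₂ f ts, h⟩))⟩⟩

theorem not_var_acKBO (x : V) (t : L.Term V) : ¬ acKBO ac prec W (.var x) t := by
  intro h
  rcases ((acKBO_iff ac prec W _ _).1 h).2 with hw | ⟨-, ⟨f, k, y, hk, -, h⟩ |
    ⟨_, _, _, _, _, _, h, _⟩ | ⟨_, _, _, _, h, _⟩ | ⟨f, -, _, _, _, _, h, _⟩⟩
  · exact absurd (W.w₀_le_weight t) (not_le.2 hw)
  · obtain ⟨k, rfl⟩ := Nat.exists_eq_succ_of_ne_zero hk.ne'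
    rw [Function.iterate_succ_apply'] at h
    cases h
  · cases h
  · cases h
  · cases h

/-- A variable is smaller than exactly those terms that properly contain it. -/
theorem acKBO_var_iff (hprec : IsPrecedence prec) (hW : W.Admissible prec) {s : L.Term V} {x : V} :
    acKBO ac prec W s (.var x) ↔ 0 < varCount x s ∧ s ≠ .var x := by
  have hx : varCount x (.var x : L.Term V) = 1 := if_pos rfl
  constructor
  · intro h
    refine ⟨hx.symm.trans_le (h.varCount_le x), ?_⟩
    rintro rfl
    exact not_var_acKBO _ _ h
  · rintro ⟨hpos, hne⟩
    have hv : ∀ y, varCount y s ≥ varCount y (.var x : L.Term V) := by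
      intro y
      by_cases hxy : x = y
      · subst hxy
        exact hx.le.trans hpos
      · rw [varCount, if_neg hxy]
        exact Nat.zero_le _
    rcases (W.w₀_le_weight s).lt_or_eq with hw | hw
    · exact acKBO_of_weight hv hw
    · rcases eq_iterate_of_weight_le hprec hW hpos hw.ge with h | ⟨f, k, hk, -, h⟩
      · exact absurd h hne
      · exact (acKBO_iff ac prec W _ _).2 ⟨hv, Or.inr ⟨hw.symm, Or.inl ⟨f, k, x, hk, rfl, h⟩⟩⟩

/-- The elimination rule for comparisons of terms of the same weight whose right-hand side is not a
variable. -/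
theorem acKBO.cases_of_weight_eq {s t : L.Term V} (h : acKBO ac prec W s t)
    (hw : W.weight s = W.weight t) (ht : ¬ ∃ x, t = .var x) :
    (∃ g h, root s = some g ∧ root t = some h ∧ prec g h) ∨
    (∃ (n : ℕ) (f : L.Functions n) (ss ts : Fin n → L.Term V),
      s = .func f ss ∧ t = .func f ts ∧ (∀ g ∈ ac, (⟨n, f⟩ : FSym L) ≠ ⟨2, g⟩) ∧
      lexGt (ACEq ac) (acKBO ac prec W) ss ts) ∨
    (∃ f ∈ ac, root s = some ⟨2, f⟩ ∧ root t = some ⟨2, f⟩ ∧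
      FlatStep ac prec (acKBO ac prec W) ⟨2, f⟩ (topFlat f s) (topFlat f t)) := by
  rcases ((acKBO_iff ac prec W _ _).1 h).2 with hw | ⟨-, ⟨f, k, y, hk, h, -⟩ |
    ⟨n, m, f, g, ss, ts, rfl, rfl, hp⟩ | h | ⟨f, hf, s₁, s₂, t₁, t₂, rfl, rfl, hflat⟩⟩
  · omega
  · exact absurd ⟨y, h⟩ ht
  · exact Or.inl ⟨_, _, rfl, rfl, hp⟩
  · exact Or.inr (Or.inl h)
  · exact Or.inr (Or.inr ⟨f, hf, rfl, rfl, hflat⟩)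

theorem root_ne_of_not_mem_ac {n : ℕ} {f : L.Functions n} {ss : Fin n → L.Term V}
    (hf : ∀ g ∈ ac, (⟨n, f⟩ : FSym L) ≠ ⟨2, g⟩) {g : L.Functions 2} (hg : g ∈ ac) :
    root (Term.func f ss) ≠ some ⟨2, g⟩ :=
  fun h => hf g hg (Option.some.inj h)

/-! ### AC-compatibility, transitivity and irreflexivity -/

theorem size_induction {P : L.Term V → Prop}
    (h : ∀ s, (∀ u, size u < size s → P u) → P s) (s : L.Term V) : P s :=
  (measure size).wf.induction s h

theorem size_lt_of_mem_topFlat_of_root_eq {f : L.Functions 2} {s u : L.Term V}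
    (hs : root s = some ⟨2, f⟩) (h : u ∈ topFlat f s) : size u < size s := by
  obtain ⟨ss, rfl⟩ := root_eq_some.1 hs
  exact size_lt_of_mem_topFlat h

theorem acKBO_compat (hprec : IsPrecedence prec) (hW : W.Admissible prec) :
    ACCompat (V := V) ac (acKBO ac prec W) := by
  intro s
  induction s using size_induction with
  | h s ih =>
  intro s' t' t hs h ht
  by_cases htv : ∃ x, t' = .var x
  · obtain ⟨x, rfl⟩ := htv
    obtain rfl := ht.symm.eq_var
    rw [acKBO_var_iff hprec hW] at h ⊢
    refine ⟨hs.varCount_eq x ▸ h.1, ?_⟩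
    rintro rfl
    exact h.2 hs.symm.eq_var
  have hv : ∀ x, varCount x s ≥ varCount x t := fun x => by
    rw [hs.varCount_eq, ← ht.varCount_eq]
    exact h.varCount_le x
  have hw := h.weight_le
  have hws := hs.weight_eq W
  have hwt := ht.weight_eq W
  rcases hw.lt_or_eq with hw' | hw'
  · exact acKBO_of_weight hv (by omega)
  have hwst : W.weight s ≥ W.weight t := by omega
  rcases h.cases_of_weight_eq hw'.symm htv with ⟨f, g, hf, hg, hfg⟩ |
    ⟨n, f, ss, ts, rfl, rfl, hf, i, hlt, hi⟩ | ⟨f, hf, hsr, htr, hflat⟩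
  · exact acKBO_of_prec hv hwst (hs.root_eq.trans hf) (ht.root_eq.symm.trans hg) hfg
  · obtain ⟨ss', rfl, hss⟩ := (hs.args hf).2 _ rfl
    obtain ⟨ts', rfl, hts⟩ := (ht.args hf).1 _ rfl
    exact acKBO_of_lex hv hwst hf
      ⟨i, fun j hj => ((hss j).symm.trans (hlt j hj)).trans (hts j),
        ih _ (size_arg_lt f ss' i) _ _ _ (hss i).symm hi (hts i)⟩
  · have hsr' := hs.root_eq.trans hsr
    exact acKBO_of_flat hf hv hwst hsr' (ht.root_eq.symm.trans htr)
      (hflat.of_rel (hs.topFlat_rel f) (ht.topFlat_rel f)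
        fun x hx => ih x (size_lt_of_mem_topFlat_of_root_eq hsr' hx))

theorem acKBO_trans (hprec : IsPrecedence prec) (hW : W.Admissible prec) (s t u : L.Term V)
    (hst : acKBO ac prec W s t) (htu : acKBO ac prec W t u) : acKBO ac prec W s u := by
  induction s using size_induction generalizing t u with
  | h s ih =>
  have hc := acKBO_compat (V := V) (ac := ac) hprec hW
  -- Below `t`, a variable `u` occurs in `t`, hence in `s`; no case analysis of `s > t` is needed.
  by_cases huv : ∃ x, u = .var x
  · obtain ⟨x, rfl⟩ := huv
    rw [acKBO_var_iff hprec hW] at htu ⊢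
    refine ⟨htu.1.trans_le (hst.varCount_le x), ?_⟩
    rintro rfl
    exact not_var_acKBO _ _ hst
  have htv : ¬ ∃ x, t = .var x := by
    rintro ⟨x, rfl⟩
    exact not_var_acKBO _ _ htu
  have hv : ∀ x, varCount x s ≥ varCount x u :=
    fun x => (htu.varCount_le x).trans (hst.varCount_le x)
  have h₁ := hst.weight_le
  have h₂ := htu.weight_le
  rcases (h₂.trans h₁).lt_or_eq with hw | hw
  · exact acKBO_of_weight hv hw
  have hwsu : W.weight s ≥ W.weight u := hw.le
  rcases hst.cases_of_weight_eq (by omega) htv with ⟨f, g, hf, hg, hfg⟩ |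
      ⟨n, f, ss, ts, rfl, rfl, hf, i, hlt, hi⟩ | ⟨f, hf, hsr, htr, hflat⟩ <;>
    rcases htu.cases_of_weight_eq (by omega) huv with ⟨f', g', hf', hg', hfg'⟩ |
      ⟨n', f', ss', ts', hs', rfl, hf', i', hlt', hi'⟩ | ⟨f', hf', hsr', htr', hflat'⟩
  · obtain rfl := Option.some.inj (hg.symm.trans hf')
    exact acKBO_of_prec hv hwsu hf hg' (hprec.trans _ _ _ hfg hfg')
  · obtain rfl := hs'
    exact acKBO_of_prec hv hwsu hf hg hfg
  · exact acKBO_of_prec hv hwsu hf (htr'.trans (hsr'.symm.trans hg)) hfg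
  · obtain rfl := Option.some.inj hf'
    exact acKBO_of_prec hv hwsu rfl hg' hfg'
  · cases hs'
    refine acKBO_of_lex hv hwsu hf ?_
    rcases lt_trichotomy i i' with h | rfl | h
    · exact ⟨i, fun j hj => (hlt j hj).trans (hlt' j (hj.trans h)),
        hc _ _ _ _ (.refl _) hi (hlt' i h)⟩
    · exact ⟨i, fun j hj => (hlt j hj).trans (hlt' j hj), ih _ (size_arg_lt f ss i) _ _ hi hi'⟩
    · exact ⟨i', fun j hj => (hlt j (hj.trans h)).trans (hlt' j hj),
        hc _ _ _ _ (hlt i' h) hi' (.refl _)⟩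
  · exact absurd hsr' (root_ne_of_not_mem_ac hf hf')
  · obtain rfl := Option.some.inj (hf'.symm.trans htr)
    exact acKBO_of_prec hv hwsu hsr hg' hfg'
  · rw [hs'] at htr
    exact absurd htr (root_ne_of_not_mem_ac hf' hf)
  · have hff := hsr'.symm.trans htr
    simp only [Option.some.injEq, Sigma.mk.injEq, heq_eq_eq, true_and] at hff
    subst hff
    exact acKBO_of_flat hf hv hwsu hsr htr' (hflat.trans hc
      (fun x hx => ih x (size_lt_of_mem_topFlat_of_root_eq hsr hx)) hflat')

theorem acKBO_irrefl (hprec : IsPrecedence prec) (hW : W.Admissible prec) (s : L.Term V) :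
    ¬ acKBO ac prec W s s := by
  induction s using size_induction with
  | h s ih =>
  intro h
  by_cases hsv : ∃ x, s = .var x
  · obtain ⟨x, rfl⟩ := hsv
    exact not_var_acKBO _ _ h
  rcases h.cases_of_weight_eq rfl hsv with ⟨f, g, hf, hg, hfg⟩ |
    ⟨n, f, ss, ts, rfl, hs, hf, i, hlt, hi⟩ | ⟨f, hf, hsr, -, hflat⟩
  · obtain rfl := Option.some.inj (hf.symm.trans hg)
    exact hprec.irrefl _ hfg
  · cases hs
    exact ih _ (size_arg_lt f ss i) hi
  · exact FlatStep.irrefl (acKBO_compat hprec hW) (acKBO_trans hprec hW)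
      (fun x hx => ih x (size_lt_of_mem_topFlat_of_root_eq hsr hx)) hflat

/-! ### Subterm property -/

/-- The only case of the subterm property in which the weights agree. Below a second occurrence of
`f` the comparison is lexicographic and descends to the argument, below another symbol `f` wins by
admissibility. -/
theorem acKBO_unary (hprec : IsPrecedence prec) (hW : W.Admissible prec) {f : L.Functions 1}
    (hf : W.w ⟨1, f⟩ = 0) (ts : Fin 1 → L.Term V) : acKBO ac prec W (Term.func f ts) (ts 0) := by
  have hts : ts = fun _ => ts 0 := funext fun i => congrArg ts (Subsingleton.elim i 0)
  rw [hts]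
  generalize ts 0 = t
  induction t with
  | var x =>
    rw [acKBO_var_iff hprec hW]
    simp [varCount]
  | func g us ih =>
    have hv := varCount_arg_le f (fun _ => Term.func g us) 0
    have hw := W.weight_arg_le f (fun _ => Term.func g us) 0
    rename_i m
    by_cases hgf : (⟨m, g⟩ : FSym L) = ⟨1, f⟩
    · cases hgf
      refine acKBO_of_lex hv hw (fun g _ h => ?_) ⟨0, fun j hj => absurd hj (by simp), ?_⟩
      · exact absurd (congrArg Sigma.fst h) (by simp)
      · have hus : us = fun _ => us 0 := funext fun i => congrArg us (Subsingleton.elim i 0)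
        have := ih 0
        rwa [← hus] at this
    · exact acKBO_of_prec hv hw rfl rfl (hW f hf _ hgf)

theorem acKBO_subterm (hprec : IsPrecedence prec) (hW : W.Admissible prec) {n : ℕ}
    (f : L.Functions n) (ts : Fin n → L.Term V) (i : Fin n) :
    acKBO ac prec W (Term.func f ts) (ts i) := by
  rcases (W.weight_arg_le f ts i).lt_or_eq with hw | hw
  · exact acKBO_of_weight (varCount_arg_le f ts i) hw
  · obtain ⟨rfl, hf⟩ := W.unary_of_weight_le hw.ge
    obtain rfl : i = 0 := Subsingleton.elim _ _
    exact acKBO_unary hprec hW hf ts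

theorem eq_or_acKBO_of_mem_topFlat (hprec : IsPrecedence prec) (hW : W.Admissible prec)
    {f : L.Functions 2} {t u : L.Term V} (h : u ∈ topFlat f t) :
    u = t ∨ acKBO ac prec W t u := by
  induction t using topFlat_induction f with
  | base t ht =>
    rw [topFlat_of_root_ne ht, Multiset.mem_singleton] at h
    exact Or.inl h
  | step ts h₀ h₁ =>
    right
    rw [topFlat_func, Multiset.mem_add] at h
    rcases h with h | h
    · have hs := acKBO_subterm (ac := ac) hprec hW f ts 0
      rcases h₀ h with rfl | h
      · exact hs
      · exact acKBO_trans hprec hW _ _ _ hs h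
    · have hs := acKBO_subterm (ac := ac) hprec hW f ts 1
      rcases h₁ h with rfl | h
      · exact hs
      · exact acKBO_trans hprec hW _ _ _ hs h

/-! ### Closure under contexts -/

theorem flatStep_singleton {f g h : FSym L} {s t : L.Term V}
    (hst : acKBO ac prec W s t) (hs : root s = some g) (ht : root t = some h)
    (hgh : prec f g → prec f h) : FlatStep ac prec (acKBO ac prec W) f {s} {t} := by
  classical
  have hmul : mulExt True (ACEq ac) (acKBO ac prec W) {s} {t} :=
    mulExt_singleton_left (by simpa using hst)
  rw [flatStep_iff]
  by_cases hfg : prec f g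
  · obtain ⟨h₁, h₂, h₃⟩ := parts_singleton_of_less hs hfg
    obtain ⟨k₁, k₂, k₃⟩ := parts_singleton_of_less ht (hgh hfg)
    refine Or.inr (Or.inr ⟨?_, rfl, by rwa [h₂, k₂]⟩)
    rw [flatExt, h₁, k₁, h₃, k₃, tsub_self]
    exact mulExt_of_le ACEq.refl le_rfl
  · left
    obtain ⟨h₁, h₂, h₃⟩ := parts_singleton_of_not_less hs hfg
    rw [flatExt, h₁]
    refine mulExt_singleton_left fun y hy => ?_
    have := Multiset.mem_of_le
      ((add_le_add le_rfl (tsub_le_self)).trans (parts_le f {t})) hy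
    rwa [Multiset.mem_singleton.1 this]

/-- Replacing a term by a smaller one of the same weight decreases its contribution to the
top-flattening of a term that contains it below `f`. -/
theorem flatStep_of_acKBO (hprec : IsPrecedence prec) (hW : W.Admissible prec)
    {s t : L.Term V} (h : acKBO ac prec W s t) (hw : W.weight s = W.weight t)
    {f : L.Functions 2} (hf : f ∈ ac) :
    FlatStep ac prec (acKBO ac prec W) ⟨2, f⟩ (topFlat f s) (topFlat f t) := by
  classical
  -- If the root of `s` is neither `f` nor smaller than `f`, then `s` alone dominates all of `t`.
  have large : ∀ g, root s = some g → g ≠ ⟨2, f⟩ → ¬ prec ⟨2, f⟩ g →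
      FlatStep ac prec (acKBO ac prec W) ⟨2, f⟩ (topFlat f s) (topFlat f t) := by
    intro g hg hgf hfg
    rw [flatStep_iff, topFlat_of_root_ne (t := s) (by rw [hg]; simpa using hgf)]
    left
    obtain ⟨h₁, -, -⟩ := parts_singleton_of_not_less hg hfg
    rw [flatExt, h₁]
    refine mulExt_singleton_left fun y hy => ?_
    have hy' := Multiset.mem_of_le
      ((add_le_add le_rfl (tsub_le_self)).trans (parts_le ⟨2, f⟩ (topFlat f t))) hy
    rcases eq_or_acKBO_of_mem_topFlat (ac := ac) hprec hW hy' with rfl | hty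
    · exact h
    · exact acKBO_trans hprec hW _ _ _ h hty
  by_cases htv : ∃ x, t = .var x
  · obtain ⟨x, rfl⟩ := htv
    obtain ⟨hx, hne⟩ := (acKBO_var_iff hprec hW).1 h
    rcases eq_iterate_of_weight_le hprec hW hx hw.le with h | ⟨g, k, hk, hg, hs⟩
    · exact absurd h hne
    · obtain ⟨k, rfl⟩ := Nat.exists_eq_succ_of_ne_zero hk.ne'
      have hgf : (⟨2, f⟩ : FSym L) ≠ ⟨1, g⟩ := fun h => absurd (congrArg Sigma.fst h) (by simp)
      -- A unary symbol of weight zero is greater than `f`, hence not smaller.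
      refine large ⟨1, g⟩ (by rw [hs, Function.iterate_succ_apply']; rfl) hgf.symm fun hfg => ?_
      exact hprec.irrefl _ (hprec.trans _ _ _ hfg (hW g hg _ hgf))
  rcases h.cases_of_weight_eq hw htv with ⟨g, g', hg, hg', hgg⟩ |
    ⟨n, g, ss, ts, rfl, rfl, hg, hlex⟩ | ⟨g, hg, hsr, htr, hflat⟩
  · -- If `s` has root `f`, then `t` counts as a single element with a root below `f`, so that the
    -- number of elements decides.
    by_cases hgf : g = ⟨2, f⟩
    · subst hgf
      have htf : root t ≠ some ⟨2, f⟩ := by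
        rw [hg']
        rintro heq
        rw [Option.some.inj heq] at hgg
        exact hprec.irrefl _ hgg
      obtain ⟨k₁, k₂, k₃⟩ := parts_singleton_of_less hg' hgg
      rw [flatStep_iff, topFlat_of_root_ne htf]
      refine Or.inr (Or.inl ⟨?_, ?_⟩)
      · rw [flatExt, k₁, k₃, zero_tsub]
        exact mulExt_of_le ACEq.refl (Multiset.zero_le _)
      · obtain ⟨ss, rfl⟩ := root_eq_some.1 hg
        have h₀ := one_le_card_topFlat f (ss 0)
        have h₁ := one_le_card_topFlat f (ss 1)
        rw [topFlat_func, Multiset.card_add, Multiset.card_singleton]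
        omega
    · by_cases hfg : prec ⟨2, f⟩ g
      · have hfg' := hprec.trans _ _ _ hfg hgg
        have hg'f : g' ≠ ⟨2, f⟩ := by
          rintro rfl
          exact hprec.irrefl _ hfg'
        rw [topFlat_of_root_ne (t := s) (by rw [hg]; simpa using hgf),
          topFlat_of_root_ne (t := t) (by rw [hg']; simpa using hg'f)]
        exact flatStep_singleton h hg hg' fun _ => hfg'
      · exact large g hg hgf hfg
  · rw [topFlat_of_root_ne (root_ne_of_not_mem_ac hg hf),
      topFlat_of_root_ne (root_ne_of_not_mem_ac hg hf)]
    exact flatStep_singleton h rfl rfl id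
  · by_cases hgf : g = f
    · subst hgf
      exact hflat
    · have hne : ∀ {u : L.Term V}, root u = some ⟨2, g⟩ → root u ≠ some ⟨2, f⟩ := by
        intro u hu
        rw [hu]
        simpa using hgf
      rw [topFlat_of_root_ne (hne hsr), topFlat_of_root_ne (hne htr)]
      exact flatStep_singleton h hsr htr id

theorem sum_update {A M : Type*} [AddCommMonoid M] {n : ℕ} (F : A → M) (ts : Fin n → A)
    (i : Fin n) (s : A) :
    ∑ j, F (Function.update ts i s j) = F s + ∑ j ∈ Finset.univ.erase i, F (ts j) := by
  rw [← Finset.add_sum_erase _ _ (Finset.mem_univ i), Function.update_self]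
  congr 1
  refine Finset.sum_congr rfl fun j hj => ?_
  rw [Function.update_of_ne (Finset.ne_of_mem_erase hj)]

end Order

section Closure

variable {L : FirstOrder.Language.{u, v}} {V : Type u'} {ac : Set (L.Functions 2)}
  {prec : FSym L → FSym L → Prop} {W : WeightFunction L}

theorem acKBO_update (hprec : IsPrecedence prec) (hW : W.Admissible prec) {s t : L.Term V}
    (h : acKBO ac prec W s t) {n : ℕ} (f : L.Functions n) (i : Fin n) (ts : Fin n → L.Term V) :
    acKBO ac prec W (.func f (Function.update ts i s)) (.func f (Function.update ts i t)) := by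
  have hv : ∀ x, varCount x (Term.func f (Function.update ts i s)) ≥
      varCount x (Term.func f (Function.update ts i t)) := by
    intro x
    rw [varCount, varCount, sum_update, sum_update]
    exact Nat.add_le_add_right (h.varCount_le x) _
  have hwle := h.weight_le
  have hw : ∀ u : L.Term V, W.weight (Term.func f (Function.update ts i u)) =
      W.w ⟨n, f⟩ + (W.weight u + ∑ j ∈ Finset.univ.erase i, W.weight (ts j)) := by
    intro u
    rw [WeightFunction.weight, sum_update]
  have hle : W.weight (Term.func f (Function.update ts i s)) ≥
      W.weight (Term.func f (Function.update ts i t)) := by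
    rw [hw, hw]
    omega
  by_cases hac : ∃ g ∈ ac, (⟨n, f⟩ : FSym L) = ⟨2, g⟩
  · obtain ⟨g, hg, hfg⟩ := hac
    obtain rfl : n = 2 := congrArg Sigma.fst hfg
    obtain rfl : f = g := by simpa using hfg
    rcases hwle.lt_or_eq with hlt | heq
    · refine acKBO_of_weight hv ?_
      rw [hw, hw]
      omega
    · refine acKBO_of_flat hg hv hle rfl rfl ?_
      have hflat : ∀ u : L.Term V, topFlat f (Term.func f (Function.update ts i u)) =
          topFlat f u + ∑ j ∈ Finset.univ.erase i, topFlat f (ts j) := by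
        intro u
        rw [topFlat, if_pos rfl, sum_update]
      rw [hflat, hflat]
      exact (flatStep_of_acKBO hprec hW h heq.symm hg).add_right _
  · push Not at hac
    refine acKBO_of_lex hv hle hac ⟨i, fun j hj => ?_, by simpa using h⟩
    rw [Function.update_of_ne hj.ne, Function.update_of_ne hj.ne]
    exact .refl _

theorem acKBO_fill (hprec : IsPrecedence prec) (hW : W.Admissible prec) (C : Ctx L V)
    {s t : L.Term V} (h : acKBO ac prec W s t) : acKBO ac prec W (C.fill s) (C.fill t) := by
  induction C with
  | hole => exact h
  | app f i ts C ih => exact acKBO_update hprec hW ih f i ts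

/-! ### Closure under substitutions -/

/-- The top-flattenings of the instances of the terms in `S`. -/
noncomputable def flatSubst (f : L.Functions 2) (σ : V → L.Term V) (S : Multiset (L.Term V)) :
    Multiset (L.Term V) :=
  S.bind fun u => topFlat f (u.subst σ)

theorem flatSubst_add (f : L.Functions 2) (σ : V → L.Term V) (S T : Multiset (L.Term V)) :
    flatSubst f σ (S + T) = flatSubst f σ S + flatSubst f σ T :=
  Multiset.add_bind _ _ _

theorem card_le_card_flatSubst (f : L.Functions 2) (σ : V → L.Term V) (S : Multiset (L.Term V)) :
    S.card ≤ (flatSubst f σ S).card := by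
  induction S using Multiset.induction with
  | empty => simp
  | cons t S ih =>
    have := one_le_card_topFlat f (t.subst σ)
    rw [flatSubst, Multiset.cons_bind, Multiset.card_add, Multiset.card_cons, ← flatSubst]
    omega

/-- Instances of non-variable terms keep their root, so a substitution affects the parts of a
top-flattening only through the variables in it. -/
theorem parts_flatSubst (f : L.Functions 2) (σ : V → L.Term V) {S : Multiset (L.Term V)}
    (hS : ∀ u ∈ S, root u ≠ some ⟨2, f⟩) :
    notLessPart prec ⟨2, f⟩ (flatSubst f σ S) =
        (notLessPart prec ⟨2, f⟩ S).map (fun u => u.subst σ) +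
          notLessPart prec ⟨2, f⟩ (flatSubst f σ (varPart S)) ∧
      lessPart prec ⟨2, f⟩ (flatSubst f σ S) =
        (lessPart prec ⟨2, f⟩ S).map (fun u => u.subst σ) +
          lessPart prec ⟨2, f⟩ (flatSubst f σ (varPart S)) ∧
      varPart (flatSubst f σ S) = varPart (flatSubst f σ (varPart S)) := by
  induction S using Multiset.induction with
  | empty => simp [flatSubst, notLessPart, lessPart, varPart]
  | cons t S ih =>
    obtain ⟨i₁, i₂, i₃⟩ := ih fun u hu => hS u (Multiset.mem_cons_of_mem hu)
    have hsingle : flatSubst f σ {t} = topFlat f (t.subst σ) := Multiset.singleton_bind _ _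
    simp only [← Multiset.singleton_add, flatSubst_add, notLessPart_add, lessPart_add, varPart_add,
      i₁, i₂, i₃, hsingle, Multiset.map_add]
    cases hr : root t with
    | none =>
      obtain ⟨x, rfl⟩ := root_eq_none.1 hr
      obtain ⟨h₁, h₂, h₃⟩ := parts_singleton_var (prec := prec) ⟨2, f⟩ x
      rw [h₁, h₂, h₃, hsingle]
      simp only [Multiset.map_zero, zero_add, and_true]
      constructor <;> abel
    | some g =>
      have hr' : root (t.subst σ) = some g := by
        rw [root_subst σ (by rw [← root_eq_none, hr]; simp), hr]
      rw [topFlat_of_root_ne (by rw [hr', ← hr]; exact hS t (Multiset.mem_cons_self t S))]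
      by_cases hg : prec ⟨2, f⟩ g
      · obtain ⟨h₁, h₂, h₃⟩ := parts_singleton_of_less hr hg
        obtain ⟨k₁, k₂, k₃⟩ := parts_singleton_of_less hr' hg
        rw [h₁, h₂, h₃, k₁, k₂, k₃]
        simp [flatSubst, notLessPart, lessPart, varPart]
      · obtain ⟨h₁, h₂, h₃⟩ := parts_singleton_of_not_less hr hg
        obtain ⟨k₁, k₂, k₃⟩ := parts_singleton_of_not_less hr' hg
        rw [h₁, h₂, h₃, k₁, k₂, k₃]
        simp [flatSubst, notLessPart, lessPart, varPart]

theorem card_flatSubst (f : L.Functions 2) (σ : V → L.Term V) {S : Multiset (L.Term V)}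
    (hS : ∀ u ∈ S, root u ≠ some ⟨2, f⟩) :
    (flatSubst f σ S).card + (varPart S).card =
      S.card + (flatSubst f σ (varPart S)).card := by
  -- The sizes do not depend on the precedence: any relation can be used to split the multisets.
  obtain ⟨h₁, h₂, h₃⟩ := parts_flatSubst (prec := fun _ _ => False) f σ hS
  have hB := congrArg Multiset.card (parts_add (prec := fun _ _ => False) ⟨2, f⟩ (flatSubst f σ S))
  have hV := congrArg Multiset.card
    (parts_add (prec := fun _ _ => False) ⟨2, f⟩ (flatSubst f σ (varPart S)))
  have hc := congrArg Multiset.card (parts_add (prec := fun _ _ => False) ⟨2, f⟩ S)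
  rw [h₁, h₂, h₃] at hB
  simp only [Multiset.card_add, Multiset.card_map] at hB hV hc
  omega

theorem mulExt_singleton_topFlat (hprec : IsPrecedence prec) (hW : W.Admissible prec)
    (f : L.Functions 2) (t : L.Term V) :
    mulExt False (ACEq ac) (acKBO ac prec W) {t} (topFlat f t) := by
  by_cases ht : root t = some ⟨2, f⟩
  · obtain ⟨ts, rfl⟩ := root_eq_some.1 ht
    refine (mulExt_singleton_left fun u hu => ?_).imp False.elim
    refine (eq_or_acKBO_of_mem_topFlat hprec hW hu).resolve_left ?_
    rintro rfl
    exact root_ne_of_mem_topFlat hu rfl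
  · rw [topFlat_of_root_ne ht]
    exact mulExt_of_le ACEq.refl le_rfl

open Classical in
theorem flatExt.subst (hprec : IsPrecedence prec) (hW : W.Admissible prec) {p : Prop}
    {f : L.Functions 2} (σ : V → L.Term V) {S T : Multiset (L.Term V)}
    (hS : ∀ u ∈ S, root u ≠ some ⟨2, f⟩) (hT : ∀ u ∈ T, root u ≠ some ⟨2, f⟩)
    (hσ : ∀ x ∈ S, ∀ y, acKBO ac prec W x y → acKBO ac prec W (x.subst σ) (y.subst σ))
    (h : flatExt p ac prec (acKBO ac prec W) ⟨2, f⟩ S T) :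
    flatExt p ac prec (acKBO ac prec W) ⟨2, f⟩ (flatSubst f σ S) (flatSubst f σ T) := by
  have hc := acKBO_compat (V := V) (ac := ac) hprec hW
  have htr : ∀ M : Multiset (L.Term V), ∀ x ∈ M, ∀ y z, acKBO ac prec W x y →
      acKBO ac prec W y z → acKBO ac prec W x z := fun _ x _ => acKBO_trans hprec hW x
  rw [flatExt] at h ⊢
  obtain ⟨hS₁, -, hS₃⟩ := parts_flatSubst (prec := prec) f σ hS
  obtain ⟨hT₁, -, hT₃⟩ := parts_flatSubst (prec := prec) f σ hT
  -- `Z` consists of the variables of `T` that are not cancelled, `X` of those that are.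
  set Z := varPart T - varPart S with hZ
  set X := varPart T ∩ varPart S with hX
  have hTv : varPart T = X + Z := by
    ext u
    simp only [hX, hZ, Multiset.count_add, Multiset.count_inter, Multiset.count_sub]
    omega
  have hXS : X ≤ varPart S := Multiset.inter_le_right
  clear_value X
  obtain ⟨Y, hSv⟩ := Multiset.le_iff_exists_add.1 hXS
  have h₁ := h.map (fun u => u.subst σ) (fun _ _ hxy => hxy.subst σ)
    fun x hx => hσ x (mem_of_mem_notLessPart hx)
  rw [Multiset.map_add] at h₁
  have h₂ : mulExt False (ACEq ac) (acKBO ac prec W) (Z.map fun u => u.subst σ)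
      (flatSubst f σ Z) := by
    rw [← Multiset.bind_singleton]
    exact mulExt_bind fun u _ => mulExt_singleton_topFlat hprec hW f _
  have h₃ := hc.mulExt_trans (htr _) h₁ ((mulExt_of_le ACEq.refl
    (le_refl ((notLessPart prec ⟨2, f⟩ T).map fun u => u.subst σ))).add h₂)
  have h₄ := mulExt.add h₃ (mulExt_of_le (gt := acKBO ac prec W) ACEq.refl
    (le_refl (notLessPart prec ⟨2, f⟩ (flatSubst f σ (varPart S)))))
  rw [← hS₁] at h₄
  refine (hc.mulExt_trans (htr _) h₄ (mulExt_of_le ACEq.refl ?_)).imp (q := p) (by tauto)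
  clear_value Z
  rw [hT₁, hT₃, hS₃, hSv, hTv]
  simp only [flatSubst_add, notLessPart_add, varPart_add]
  rw [add_tsub_add_eq_tsub_left]
  calc _ ≤ (notLessPart prec ⟨2, f⟩ T).map (fun u => u.subst σ) +
        (notLessPart prec ⟨2, f⟩ (flatSubst f σ X) +
          notLessPart prec ⟨2, f⟩ (flatSubst f σ Z)) + varPart (flatSubst f σ Z) :=
        add_le_add le_rfl tsub_le_self
    _ = (notLessPart prec ⟨2, f⟩ T).map (fun u => u.subst σ) +
        (notLessPart prec ⟨2, f⟩ (flatSubst f σ Z) + varPart (flatSubst f σ Z)) +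
          notLessPart prec ⟨2, f⟩ (flatSubst f σ X) := by abel
    _ ≤ _ := add_le_add (add_le_add le_rfl (parts_le _ _)) (Multiset.le_add_right _ _)

open Classical in
/-- A variable of `T` that is not cancelled cannot be matched by an AC-equivalent non-variable term,
so it forces the comparison to be strict. -/
theorem flatExt.strict_of_varPart_not_le {gt : L.Term V → L.Term V → Prop} {f : FSym L}
    {S T : Multiset (L.Term V)} (h : flatExt False ac prec gt f S T)
    (hST : ¬ varPart T ≤ varPart S) : flatExt True ac prec gt f S T := by
  obtain ⟨M₁, M₂, N₁, N₂, h₁, h₂, h₃, -, h₅⟩ := h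
  refine ⟨M₁, M₂, N₁, N₂, h₁, h₂, h₃, ?_, h₅⟩
  rintro - rfl
  rw [← tsub_eq_zero_iff_le] at hST
  obtain ⟨z, hz⟩ := Multiset.exists_mem_of_ne_zero hST
  obtain ⟨x, rfl⟩ := (Multiset.mem_filter.1 (Multiset.mem_of_le tsub_le_self hz)).2
  have hmem : (.var x : L.Term V) ∈ N₁ + N₂ := h₂ ▸ Multiset.mem_add.2 (Or.inr hz)
  rcases Multiset.mem_add.1 hmem with hx | hx
  · obtain ⟨s, hs, hsx⟩ := exists_mem_left_of_rel h₃ hx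
    have hs' : s ∈ notLessPart prec f S := by
      rw [h₁]
      exact Multiset.mem_add.2 (Or.inl hs)
    obtain ⟨g, hg, -⟩ := (Multiset.mem_filter.1 hs').2
    rw [hsx.eq_var] at hg
    cases hg
  · obtain ⟨s, hs, -⟩ := h₅ _ hx
    exact absurd hs (Multiset.notMem_zero s)

theorem FlatStep.subst (hprec : IsPrecedence prec) (hW : W.Admissible prec)
    {f : L.Functions 2} (σ : V → L.Term V) {S T : Multiset (L.Term V)}
    (hS : ∀ u ∈ S, root u ≠ some ⟨2, f⟩) (hT : ∀ u ∈ T, root u ≠ some ⟨2, f⟩)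
    (hσ : ∀ x ∈ S, ∀ y, acKBO ac prec W x y → acKBO ac prec W (x.subst σ) (y.subst σ))
    (h : FlatStep ac prec (acKBO ac prec W) ⟨2, f⟩ S T) :
    FlatStep ac prec (acKBO ac prec W) ⟨2, f⟩ (flatSubst f σ S) (flatSubst f σ T) := by
  have key : ∀ {p : Prop}, flatExt p ac prec (acKBO ac prec W) ⟨2, f⟩ S T →
      flatExt p ac prec (acKBO ac prec W) ⟨2, f⟩ (flatSubst f σ S) (flatSubst f σ T) :=
    fun h => h.subst hprec hW σ hS hT hσ
  rw [flatStep_iff] at h ⊢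
  -- `Y` consists of the uncancelled variables of `S`; their instances only enlarge the left side.
  by_cases hST : varPart T ≤ varPart S
  · obtain ⟨Y, hY⟩ := Multiset.le_iff_exists_add.1 hST
    have hSc := card_flatSubst f σ hS
    have hTc := card_flatSubst f σ hT
    have hYc := card_le_card_flatSubst f σ Y
    rw [hY, flatSubst_add, Multiset.card_add, Multiset.card_add] at hSc
    rcases h with h | ⟨h, hcard⟩ | ⟨h, hcard, hless⟩
    · exact Or.inl (key h)
    · exact Or.inr (Or.inl ⟨key h, by omega⟩)
    · refine Or.inr ?_
      have hcard' : (flatSubst f σ T).card ≤ (flatSubst f σ S).card := by omega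
      refine hcard'.lt_or_eq.imp (fun hlt => ⟨key h, hlt⟩) fun heq => ⟨key h, heq.symm, ?_⟩
      rw [(parts_flatSubst f σ hS).2.1, (parts_flatSubst f σ hT).2.1, hY, flatSubst_add,
        lessPart_add]
      exact ((hless.map (fun u => u.subst σ) (fun _ _ hxy => hxy.subst σ)
        fun x hx => hσ x (mem_of_mem_lessPart hx)).add
          (mulExt_of_le ACEq.refl (Multiset.le_add_right _ _))).imp (by simp)
  · refine Or.inl (key ?_)
    rcases h with h | ⟨h, -⟩ | ⟨h, -⟩
    · exact h
    · exact h.strict_of_varPart_not_le hST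
    · exact h.strict_of_varPart_not_le hST

theorem eq_or_acKBO_subst_of_varCount_pos (hprec : IsPrecedence prec) (hW : W.Admissible prec)
    (σ : V → L.Term V) {s : L.Term V} {x : V} (hx : 0 < varCount x s) :
    s = .var x ∨ acKBO ac prec W (s.subst σ) (σ x) := by
  induction s with
  | var y =>
    left
    by_contra hne
    rw [varCount, if_neg] at hx
    · exact lt_irrefl _ hx
    · rintro rfl
      exact hne rfl
  | func f ts ih =>
    right
    obtain ⟨i, hi⟩ := exists_varCount_pos hx
    have hsub := acKBO_subterm (ac := ac) hprec hW f (fun i => (ts i).subst σ) i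
    rcases ih i hi with h | h
    · simpa only [h, Term.subst] using hsub
    · exact acKBO_trans hprec hW _ _ _ hsub h

theorem acKBO_subst (hprec : IsPrecedence prec) (hW : W.Admissible prec) (σ : V → L.Term V)
    (s t : L.Term V) (h : acKBO ac prec W s t) :
    acKBO ac prec W (s.subst σ) (t.subst σ) := by
  induction s using size_induction generalizing t with
  | h s ih =>
  by_cases htv : ∃ x, t = .var x
  · obtain ⟨x, rfl⟩ := htv
    obtain ⟨hx, hne⟩ := (acKBO_var_iff hprec hW).1 h
    exact (eq_or_acKBO_subst_of_varCount_pos hprec hW σ hx).resolve_left hne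
  have hv := varCount_subst_le σ h.varCount_le
  have hw := W.weight_subst_add_le σ h.varCount_le
  rcases h.weight_le.lt_or_eq with hlt | heq
  · exact acKBO_of_weight hv (by omega)
  have hle : W.weight (s.subst σ) ≥ W.weight (t.subst σ) := by omega
  rcases h.cases_of_weight_eq heq.symm htv with ⟨f, g, hf, hg, hfg⟩ |
    ⟨n, f, ss, ts, rfl, rfl, hf, i, hlt, hi⟩ | ⟨f, hf, hsr, htr, hflat⟩
  · have hsv : ¬ ∃ x, s = .var x := by
      rw [← root_eq_none, hf]
      simp
    exact acKBO_of_prec hv hle ((root_subst σ hsv).trans hf) ((root_subst σ htv).trans hg) hfg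
  · exact acKBO_of_lex hv hle hf
      ⟨i, fun j hj => (hlt j hj).subst σ, ih _ (size_arg_lt f ss i) _ hi⟩
  · have hsv : ¬ ∃ x, s = .var x := by
      rw [← root_eq_none, hsr]
      simp
    refine acKBO_of_flat hf hv hle ((root_subst σ hsv).trans hsr) ((root_subst σ htv).trans htr) ?_
    rw [topFlat_subst, topFlat_subst]
    exact hflat.subst hprec hW σ (fun u => root_ne_of_mem_topFlat) (fun u => root_ne_of_mem_topFlat)
      fun x hx => ih x (size_lt_of_mem_topFlat_of_root_eq hsr hx)

end Closure

end ACKBO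

theorem mainTheorem1 {L : FirstOrder.Language} {V : Type*}
    (ac : Set (L.Functions 2))
    (prec : ACKBO.FSym L → ACKBO.FSym L → Prop) (hprec : ACKBO.IsPrecedence prec)
    (W : ACKBO.WeightFunction L) (hW : W.Admissible prec) :
    ACKBO.IsACSimplificationOrder ac
      (ACKBO.acKBO ac prec W : L.Term V → L.Term V → Prop) where
  irrefl := ACKBO.acKBO_irrefl hprec hW
  trans := ACKBO.acKBO_trans hprec hW
  closed_ctx C _ _ h := ACKBO.acKBO_fill hprec hW C h
  closed_subst := ACKBO.acKBO_subst hprec hW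
  subterm := ACKBO.acKBO_subterm hprec hW
  ac_compat := ACKBO.acKBO_compat hprec hW
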